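/- **Definitions.** A *signature* is a finite label set $\Sigma$ with a map $\mathrm{type}:\Sigma\to\mathbb N$. A *hypergraph* $H$ over it has finite sets of nodes and hyperedges, a label $\mathrm{lab}(e)\in\Sigma$ and a sequence $\mathrm{att}(e)$ of $\mathrm{type}(\mathrm{lab}(e))$ nodes for each hyperedge $e$, and a sequence $\mathrm{ext}$ of external nodes, whose length is the *type* of $H$; it is *repetition-free* if its external nodes are pairwise distinct. A *rule* is a pair $(X,R)$ of a label and a hypergraph of the same type; it is repetition-free if $R$ is. Replacing a hyperedge $e$ by $R$ means deleting $e$, adding a disjoint copy of $R$ and identifying the $i$-th external node of $R$ with the $i$-th attachment node of $e$, for every $i$. The handle $X^\bullet$ is a single hyperedge labelled $X$ on $\mathrm{type}(X)$ distinct nodes, which are, in the same order, its external nodes. The *string graph* of $w=a_1\cdots a_n$ (all $a_i$ of type 2) has nodes $v_0,\dots,v_n$, hyperedges $e_i$ labelled $a_i$ and attached to $v_{i-1}v_i$, and external sequence $v_0v_n$. Hypergraphs are considered up to isomorphism. A *$k$-HR grammar* consists of a signature, a set $N\subseteq\Sigma$ of nonterminals, a start symbol $S\in N$ and a finite set of rules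 with left-hand sides in $N$, all of type at most $k$. It generates all hypergraphs without nonterminal labels that are obtained from $S^\bullet$ by finitely many steps (possibly none), each replacing one hyperedge according to a rule for its label. A *$k$-PHR grammar* consists of a signature, a set of terminals $\subseteq\Sigma$, a start symbol $S\in\Sigma$ and a non-empty finite family of tables, a table being a finite set of rules of type at most $k$ that contains at least one rule for every label of $\Sigma$. It generates all hypergraphs with only terminal labels that are obtained from $S^\bullet$ by finitely many steps (possibly none), each choosing one table and simultaneously replacing every hyperedge according to some rule of this table for its label. A grammar is repetition-free if all its rules are. A string language $L\subseteq A^*$ over a finite alphabet $A$ is a (repetition-free) *$k$-HRS*, respectively *$k$-PHRS*, language if some (repetition-free) $k$-HR, respectively $k$-PHR, grammar generates only string graphs and the set of strings they represent is $L\setminus\{\varepsilon\}$. The classes of repetition-free $k$-HRS and $k$-PHRS languages are denoted $\mathcal{HRS}_k^{\mathrm{rf}}$ and $\mathcal{PHRS}_k^{\mathrm{rf}}$; $\mathcal{PHRS}$ is the class of all $k$-PHRS languages, $k\ge2$ (not necessarily repetition-free). $\mathcal{MCF}$ is the class of languages of multiple context-free grammars: each nonterminal $X$ has a dimension $d(X)\geq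 1$ and generates $d(X)$-tuples of strings, the start symbol has dimension 1, and there are finitely many rules $X\to f[Y_1,\dots,Y_q]$ ($q\ge0$), where every component of the value of $f$ is a concatenation of letters and components of the arguments and every component of an argument is used at most once in total. **Theorem (PHRS Generalises MCF).** For every $k\ge2$, $$\mathcal{HRS}_k^{\mathrm{rf}}\subsetneq\mathcal{PHRS}_k^{\mathrm{rf}},$$ and moreover $\mathcal{MCF}\subsetneq\mathcal{PHRS}$. Both inclusions hold for languages over every finite alphabet $A$, and both are strict already for languages over any fixed non-empty finite alphabet $A$. -/

import Mathlib

/-- A hypergraph over the signature with label set `Lab` and typing function `ty`: finite sets of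
nodes and hyperedges, an attachment sequence and a label for each hyperedge (compatible with
typing), and a sequence of external nodes. -/
structure HGraph {Lab : Type} (ty : Lab → ℕ) : Type 1 where
  V : Type
  E : Type
  finite_V : Finite V
  finite_E : Finite E
  att : E → List V
  lab : E → Lab
  ext : List V
  att_length : ∀ e, (att e).length = ty (lab e)

namespace HGraph

variable {Lab : Type} {ty : Lab → ℕ}

/-- The type of a hypergraph: the length of its sequence of external nodes. -/
abbrev type (H : HGraph ty) : ℕ := H.ext.length

/-- A hypergraph is repetition-free if its external nodes are pairwise distinct. -/
def RepetitionFree (H : HGraph ty) : Prop := H.ext.Nodup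

/-- Isomorphism of hypergraphs. -/
def Iso (G H : HGraph ty) : Prop :=
  ∃ (gV : G.V ≃ H.V) (gE : G.E ≃ H.E),
    (∀ e, H.att (gE e) = (G.att e).map gV) ∧
    (∀ e, H.lab (gE e) = G.lab e) ∧
    G.ext.map gV = H.ext

/-- The handle of a label `X`: one hyperedge labelled `X`, attached to `ty X` distinct nodes,
which are also the external nodes, in the same order. -/
abbrev handle (ty : Lab → ℕ) (X : Lab) : HGraph ty where
  V := Fin (ty X)
  E := Unit
  finite_V := inferInstance
  finite_E := inferInstance
  att _ := List.finRange (ty X)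
  lab _ := X
  ext := List.finRange (ty X)
  att_length _ := List.length_finRange

/-- The string graph of a string `w` of type 2 labels: a directed path whose consecutive
hyperedges carry the letters of `w`, with the two endpoints as external nodes. -/
abbrev stringGraph (w : List Lab) (hw : ∀ a ∈ w, ty a = 2) : HGraph ty where
  V := Fin (w.length + 1)
  E := Fin w.length
  finite_V := inferInstance
  finite_E := inferInstance
  att i := [i.castSucc, i.succ]
  lab i := w.get i
  ext := [0, Fin.last w.length]
  att_length i := (hw _ (List.get_mem w i)).symm

/-- `H` is a string graph representing `w`, that is, `STR H = w`. -/
def Represents (H : HGraph ty) (w : List Lab) : Prop :=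
  ∃ hw : ∀ a ∈ w, ty a = 2, H.Iso (stringGraph w hw)

/-- The identifications made when each `e ∈ B` is replaced by `σ e`: the `i`-th attachment node
of `e` is glued to the `i`-th external node of `σ e`. -/
inductive Glue (H : HGraph ty) (B : Set H.E) (σ : B → HGraph ty) :
    H.V ⊕ (Σ e : B, (σ e).V) → H.V ⊕ (Σ e : B, (σ e).V) → Prop
  | glue (e : B) (i : ℕ) (v : H.V) (u : (σ e).V)
      (hv : (H.att e)[i]? = some v) (hu : (σ e).ext[i]? = some u) :
      Glue H B σ (Sum.inl v) (Sum.inr ⟨e, u⟩)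

/-- The replacement `H[σ]`: remove the hyperedges in `B`, add disjoint copies of the hypergraphs
`σ e` and identify nodes according to the equivalence relation generated by `Glue`. It is only
used when `σ` is a replacement function, i.e. `σ e` has the type of `e` for each `e ∈ B`. -/
abbrev replace (H : HGraph ty) (B : Set H.E) (σ : B → HGraph ty) : HGraph ty where
  V := Quot (Glue H B σ)
  E := {e : H.E // e ∉ B} ⊕ (Σ e : B, (σ e).E)
  finite_V := by
    have := H.finite_V
    have := H.finite_E
    have := fun e => (σ e).finite_V
    infer_instance
  finite_E := by
    have := H.finite_E
    have := fun e => (σ e).finite_E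
    infer_instance
  att
    | Sum.inl e => (H.att e).map fun v => Quot.mk _ (Sum.inl v)
    | Sum.inr ⟨e, f⟩ => ((σ e).att f).map fun u => Quot.mk _ (Sum.inr ⟨e, u⟩)
  lab
    | Sum.inl e => H.lab e
    | Sum.inr ⟨e, f⟩ => (σ e).lab f
  ext := H.ext.map fun v => Quot.mk _ (Sum.inl v)
  att_length
    | Sum.inl e => by simpa using H.att_length e
    | Sum.inr ⟨e, f⟩ => by simpa using (σ e).att_length f

end HGraph

/-- A rule `(L, R)`: a label and a hypergraph of the same type. -/
structure HyperRule {Lab : Type} (ty : Lab → ℕ) : Type 1 where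
  lhs : Lab
  rhs : HGraph ty
  type_eq : ty lhs = rhs.type

section Derivations

variable {Lab : Type} {ty : Lab → ℕ}

/-- Direct derivation: some hyperedge `e` is replaced by the right-hand side of a rule for its
label; the result is taken up to isomorphism. -/
def DirectlyDerives (R : Set (HyperRule ty)) (H H' : HGraph ty) : Prop :=
  ∃ e : H.E, ∃ r ∈ R, r.lhs = H.lab e ∧ H'.Iso (H.replace {e} fun _ => r.rhs)

/-- Derivation: at least one direct derivation, or isomorphism. -/
def Derives (R : Set (HyperRule ty)) (H H' : HGraph ty) : Prop :=
  Relation.TransGen (DirectlyDerives R) H H' ∨ H.Iso H'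

/-- Parallel direct derivation: every hyperedge is replaced by the right-hand side of a rule of
the table `T` for its label; the result is taken up to isomorphism. -/
def ParallelDirectlyDerives (T : Set (HyperRule ty)) (H H' : HGraph ty) : Prop :=
  ∃ ρ : H.E → HyperRule ty, (∀ e, ρ e ∈ T ∧ (ρ e).lhs = H.lab e) ∧
    H'.Iso (H.replace Set.univ fun e => (ρ e).rhs)

/-- Parallel derivation: at least one parallel direct derivation, each with one of the tables
`T i`, or isomorphism. -/
def ParallelDerives {I : Type} (T : I → Set (HyperRule ty)) (H H' : HGraph ty) : Prop :=
  Relation.TransGen (fun G G' => ∃ i, ParallelDirectlyDerives (T i) G G') H H' ∨ H.Iso H'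

/-- A set of rules over the label set is a table if it is finite and has at least one rule for
each label. -/
def IsTable (T : Set (HyperRule ty)) : Prop :=
  T.Finite ∧ ∀ X : Lab, ∃ r ∈ T, r.lhs = X

/-- All hypergraphs in the language are string graphs. -/
def IsStringGraphLanguage (𝓛 : Set (HGraph ty)) : Prop :=
  ∀ H ∈ 𝓛, ∃ w, H.Represents w

/-- The string language `STR(𝓛)` of a language of string graphs. -/
def STR (𝓛 : Set (HGraph ty)) : Set (List Lab) :=
  {w | ∃ H ∈ 𝓛, H.Represents w}

/-- `𝓛` is a string graph language and `STR(𝓛) = L \ {ε}`, where the letters of the alphabet `A`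
are regarded as labels via the injection `ι`. -/
def GeneratesString {A : Type*} (𝓛 : Set (HGraph ty)) (ι : A ↪ Lab) (L : Language A) : Prop :=
  IsStringGraphLanguage 𝓛 ∧ STR 𝓛 = List.map ι '' {w | w ∈ L ∧ w ≠ []}

end Derivations

/-- A hyperedge replacement grammar. -/
structure HRGrammar : Type 1 where
  Lab : Type
  finite_Lab : Finite Lab
  ty : Lab → ℕ
  nonterminals : Set Lab
  start : Lab
  start_mem : start ∈ nonterminals
  rules : Set (HyperRule ty)
  finite_rules : rules.Finite
  lhs_mem : ∀ r ∈ rules, r.lhs ∈ nonterminals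

namespace HRGrammar

/-- All rules have type at most `k`. -/
def HasOrder (G : HRGrammar) (k : ℕ) : Prop := ∀ r ∈ G.rules, G.ty r.lhs ≤ k

def RepetitionFree (G : HRGrammar) : Prop := ∀ r ∈ G.rules, r.rhs.RepetitionFree

/-- The derivable hypergraphs without nonterminal hyperedges. -/
def language (G : HRGrammar) : Set (HGraph G.ty) :=
  {H | Derives G.rules (HGraph.handle G.ty G.start) H ∧ ∀ e, H.lab e ∉ G.nonterminals}

end HRGrammar

/-- A parallel hyperedge replacement grammar. -/
structure PHRGrammar : Type 1 where
  Lab : Type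
  finite_Lab : Finite Lab
  ty : Lab → ℕ
  terminals : Set Lab
  start : Lab
  I : Type
  finite_I : Finite I
  nonempty_I : Nonempty I
  tables : I → Set (HyperRule ty)
  isTable : ∀ i, IsTable (tables i)

namespace PHRGrammar

/-- All rules have type at most `k`. -/
def HasOrder (G : PHRGrammar) (k : ℕ) : Prop := ∀ i, ∀ r ∈ G.tables i, G.ty r.lhs ≤ k

def RepetitionFree (G : PHRGrammar) : Prop := ∀ i, ∀ r ∈ G.tables i, r.rhs.RepetitionFree

/-- The derivable hypergraphs all of whose hyperedges are labelled by terminals. -/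
def language (G : PHRGrammar) : Set (HGraph G.ty) :=
  {H | ParallelDerives G.tables (HGraph.handle G.ty G.start) H ∧ ∀ e, H.lab e ∈ G.terminals}

end PHRGrammar

/-- The repetition-free hyperedge replacement string languages of order `k` over the
alphabet `A`. -/
def RepetitionFreeHRS (A : Type*) (k : ℕ) : Set (Language A) :=
  {L | ∃ (G : HRGrammar) (ι : A ↪ G.Lab),
    G.HasOrder k ∧ G.RepetitionFree ∧ GeneratesString G.language ι L}

/-- The repetition-free parallel hyperedge replacement string languages of order `k` over the
alphabet `A`. -/
def RepetitionFreePHRS (A : Type*) (k : ℕ) : Set (Language A) :=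
  {L | ∃ (G : PHRGrammar) (ι : A ↪ G.Lab),
    G.HasOrder k ∧ G.RepetitionFree ∧ GeneratesString G.language ι L}

/-- The parallel hyperedge replacement string languages over the alphabet `A`, of any
order `k ≥ 2`, not necessarily repetition-free. -/
def PHRS (A : Type*) : Set (Language A) :=
  {L | ∃ k, 2 ≤ k ∧ ∃ (G : PHRGrammar) (ι : A ↪ G.Lab),
    G.HasOrder k ∧ GeneratesString G.language ι L}

/-- A rule `X → f[Y₁, …, Y_q]` of a multiple context-free grammar with terminal alphabet `A`.
The variables of `f` are the pairs of a position `i` in the list `Y₁, …, Y_q` and a component of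
`Y_i`; each component of the value of `f` is a concatenation of letters and variables, and each
variable occurs at most once in all the components together. -/
structure MCFRule (A : Type*) {N : Type} (dim : N → ℕ) where
  lhs : N
  rhs : List N
  body : Fin (dim lhs) → List (A ⊕ (Σ i : Fin rhs.length, Fin (dim (rhs.get i))))
  linear : ((List.ofFn body).flatten.filterMap Sum.getRight?).Nodup

/-- A multiple context-free grammar with terminal alphabet `A`. -/
structure MCFGrammar (A : Type*) where
  N : Type
  finite_N : Finite N
  dim : N → ℕ
  dim_pos : ∀ X, 0 < dim X
  start : N
  dim_start : dim start = 1
  rules : Set (MCFRule A dim)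
  finite_rules : rules.Finite

namespace MCFGrammar

/-- The tuples of strings generated by each nonterminal: the least family closed under applying
the functions of the rules. -/
inductive Yields {A : Type*} (G : MCFGrammar A) : (X : G.N) → (Fin (G.dim X) → List A) → Prop
  | rule (r : MCFRule A G.dim) (hr : r ∈ G.rules)
      (t : (i : Fin r.rhs.length) → Fin (G.dim (r.rhs.get i)) → List A)
      (ht : ∀ i, Yields G (r.rhs.get i) (t i)) :
      Yields G r.lhs fun j =>
        (r.body j).flatMap (Sum.elim (fun a => [a]) fun v => t v.1 v.2)

/-- The generated language: the strings `w` for which the start symbol generates the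
1-tuple `(w)`. -/
def language {A : Type*} (G : MCFGrammar A) : Language A :=
  {w | G.Yields G.start fun _ => w}

end MCFGrammar

/-- The multiple context-free languages over the alphabet `A`. -/
def MCF (A : Type*) : Set (Language A) :=
  {L | ∃ G : MCFGrammar A, G.language = L}

/-!
Sequential grammars are simulated by parallel ones with a single table: add the identity rules
`X → X•`. Inserting a handle has no effect (`HGraph.replace_univ_iso`), so a sequential step is a
parallel step in which all other hyperedges are left alone, and a parallel step is a sequence of
sequential steps because replacements can be carried out one after the other
(`HGraph.replace_replace_iso`). Labels of type above `k` never lead to string graphs and are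
removed first, so the order does not grow.

For strictness, doubling every letter in parallel generates `a ^ (2 ^ n)`, while the lengths of the
words of a sequentially generated language are bounded or contain three terms `p`, `p + d`,
`p + 2d` with `d > 0`. This is a pumping argument about the number of hyperedges alone: if no
nonterminal pumps itself by a positive amount, then smallest derivation trees repeat no label on a
path (`counts_bounded_of_no_pump`). No three powers of two are in arithmetic progression.

A multiple context-free grammar is turned into a repetition-free sequential hyperedge replacement
grammar. A nonterminal of dimension `d` becomes a hyperedge with two attachments per component,
standing for `d` strings between pairs of nodes. Nonterminals carry a demand saying which
components are nonempty, empty or unused; only the nonempty ones get attachments, so that no stray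
nodes and no repetitions of external nodes arise. All hypergraphs that occur are `Threaded`:
disjoint unions of paths of components. Threaded hypergraphs are closed under replacement, and
correctness of the simulation is read off the words spelled along the paths. That the paths visit
no node twice is ensured by counting nodes: gluing along repetition-free external sequences
identifies at most one pair of nodes per attachment (`HGraph.card_replace_univ_le`).
-/


/-! ### Isomorphisms and hyperedge replacement -/

attribute [instance] HGraph.finite_V HGraph.finite_E

namespace HGraph

variable {Lab : Type} {ty ty' ty'' : Lab → ℕ}

/-- Isomorphism between hypergraphs over two typings of the same label set; for equal typings
this is `HGraph.Iso`. -/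
def CrossIso (G : HGraph ty) (H : HGraph ty') : Prop :=
  ∃ (gV : G.V ≃ H.V) (gE : G.E ≃ H.E),
    (∀ e, H.att (gE e) = (G.att e).map gV) ∧
    (∀ e, H.lab (gE e) = G.lab e) ∧
    G.ext.map gV = H.ext

theorem CrossIso.refl (G : HGraph ty) : CrossIso G G :=
  ⟨Equiv.refl _, Equiv.refl _, by simp, by simp, by simp⟩

theorem CrossIso.symm {G : HGraph ty} {H : HGraph ty'} (h : CrossIso G H) : CrossIso H G := by
  obtain ⟨gV, gE, ha, hl, hx⟩ := h
  refine ⟨gV.symm, gE.symm, fun e => ?_, fun e => ?_, ?_⟩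
  · have := ha (gE.symm e)
    simp only [Equiv.apply_symm_apply] at this
    simp [this]
  · simpa using (hl (gE.symm e)).symm
  · simp [← hx]

theorem CrossIso.trans {G : HGraph ty} {H : HGraph ty'} {K : HGraph ty''} (h : CrossIso G H)
    (h' : CrossIso H K) : CrossIso G K := by
  obtain ⟨gV, gE, ha, hl, hx⟩ := h
  obtain ⟨gV', gE', ha', hl', hx'⟩ := h'
  exact ⟨gV.trans gV', gE.trans gE', by simp [ha, ha'], by simp [hl, hl'], by simp [← hx', ← hx]⟩

theorem Iso.refl (G : HGraph ty) : G.Iso G := CrossIso.refl G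

theorem Iso.symm {G H : HGraph ty} (h : G.Iso H) : H.Iso G := CrossIso.symm h

theorem Iso.trans {G H K : HGraph ty} (h : G.Iso H) (h' : H.Iso K) : G.Iso K :=
  CrossIso.trans h h'

theorem glue_iff {H : HGraph ty} {B : Set H.E} {σ : B → HGraph ty} {v : H.V}
    {p : Σ e : B, (σ e).V} :
    Glue H B σ (Sum.inl v) (Sum.inr p) ↔
      ∃ i : ℕ, (H.att p.1)[i]? = some v ∧ (σ p.1).ext[i]? = some p.2 := by
  constructor
  · rintro ⟨e, i, v, u, hv, hu⟩
    exact ⟨i, hv, hu⟩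
  · rintro ⟨i, hv, hu⟩
    exact Glue.glue p.1 i v p.2 hv hu

theorem glue_sound {H : HGraph ty} {B : Set H.E} {σ : B → HGraph ty} {e : B} {i : ℕ} {v : H.V}
    {u : (σ e).V} (hv : (H.att e)[i]? = some v) (hu : (σ e).ext[i]? = some u) :
    Quot.mk (Glue H B σ) (Sum.inl v) = Quot.mk _ (Sum.inr ⟨e, u⟩) :=
  Quot.sound (Glue.glue e i v u hv hu)

/-- A universal way to recognise a replacement: a hypergraph `K` receiving the host and the
inserted hypergraphs compatibly with the gluing, with a node map `back` showing that no
further nodes were identified. -/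
theorem CrossIso.of_replace {H : HGraph ty} {B : Set H.E} {σ : B → HGraph ty} {K : HGraph ty'}
    (f : H.V → K.V) (g : ∀ e : B, (σ e).V → K.V) (back : K.V → Quot (Glue H B σ))
    (hglue : ∀ (e : B) (i : ℕ) (v : H.V) (u : (σ e).V),
      (H.att e)[i]? = some v → (σ e).ext[i]? = some u → f v = g e u)
    (back_f : ∀ v, back (f v) = Quot.mk _ (Sum.inl v))
    (back_g : ∀ e u, back (g e u) = Quot.mk _ (Sum.inr ⟨e, u⟩))
    (surj : ∀ y, (∃ v, f v = y) ∨ ∃ e u, g e u = y)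
    (kE : {e : H.E // e ∉ B} ⊕ (Σ e : B, (σ e).E) → K.E) (bij : kE.Bijective)
    (att_inl : ∀ e, K.att (kE (Sum.inl e)) = (H.att e).map f)
    (att_inr : ∀ e x, K.att (kE (Sum.inr ⟨e, x⟩)) = ((σ e).att x).map (g e))
    (lab_inl : ∀ e, K.lab (kE (Sum.inl e)) = H.lab e)
    (lab_inr : ∀ e x, K.lab (kE (Sum.inr ⟨e, x⟩)) = (σ e).lab x)
    (ext_eq : H.ext.map f = K.ext) : CrossIso (H.replace B σ) K := by
  let F : Quot (Glue H B σ) → K.V := Quot.lift (Sum.elim f fun p => g p.1 p.2) (by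
    rintro _ _ ⟨e, i, v, u, hv, hu⟩
    exact hglue e i v u hv hu)
  have hF : Function.LeftInverse back F := by
    rintro ⟨v | ⟨e, u⟩⟩
    · exact back_f v
    · exact back_g e u
  have hF' : Function.RightInverse back F := by
    intro y
    rcases surj y with ⟨v, rfl⟩ | ⟨e, u, rfl⟩
    · rw [back_f]; rfl
    · rw [back_g]; rfl
  refine ⟨⟨F, back, hF, hF'⟩, Equiv.ofBijective kE bij, ?_, ?_, ?_⟩
  · rintro (e | ⟨e, x⟩)
    · rw [List.map_map]; exact att_inl e
    · rw [List.map_map]; exact att_inr e x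
  · rintro (e | ⟨e, x⟩)
    · exact lab_inl e
    · exact lab_inr e x
  · rw [List.map_map]; exact ext_eq

/-- Replacement respects isomorphism. -/
theorem CrossIso.replace {G : HGraph ty} {H : HGraph ty'} {gV : G.V ≃ H.V} {gE : G.E ≃ H.E}
    (ha : ∀ e, H.att (gE e) = (G.att e).map gV) (hl : ∀ e, H.lab (gE e) = G.lab e)
    (hx : G.ext.map gV = H.ext) {B : Set G.E} {B' : Set H.E} (hB : ∀ e, e ∈ B ↔ gE e ∈ B')
    {σ : B → HGraph ty} {σ' : B' → HGraph ty'}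
    (hσ : ∀ e : B, CrossIso (σ e) (σ' ⟨gE e, (hB e).1 e.2⟩)) :
    CrossIso (G.replace B σ) (H.replace B' σ') := by
  choose sV sE sa sl sx using hσ
  let gB : B ≃ B' := gE.subtypeEquiv hB
  let Φ : G.V ⊕ (Σ e : B, (σ e).V) ≃ H.V ⊕ (Σ e : B', (σ' e).V) :=
    Equiv.sumCongr gV (Equiv.sigmaCongr gB sV)
  have hΦ : ∀ x y, Glue G B σ x y ↔ Glue H B' σ' (Φ x) (Φ y) := by
    rintro (v | p) (v' | q)
    · exact iff_of_false (by rintro ⟨⟩) (by rintro ⟨⟩)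
    · have : Φ (Sum.inl v) = Sum.inl (gV v) := rfl
      rw [this]
      have : Φ (Sum.inr q) = Sum.inr ⟨⟨gE q.1, (hB q.1).1 q.1.2⟩, sV q.1 q.2⟩ := rfl
      rw [this, glue_iff, glue_iff]
      simp [ha, ← sx]
    · exact iff_of_false (by rintro ⟨⟩) (by rintro ⟨⟩)
    · exact iff_of_false (by rintro ⟨⟩) (by rintro ⟨⟩)
  refine ⟨Quot.congr Φ hΦ, Equiv.sumCongr (gE.subtypeEquiv fun e => not_congr (hB e))
    (Equiv.sigmaCongr gB sE), ?_, ?_, ?_⟩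
  · rintro (e | ⟨e, x⟩)
    · change (H.att (gE e)).map _ = _
      rw [ha]
      simp only [List.map_map]
      rfl
    · have h : (G.replace B σ).att (Sum.inr ⟨e, x⟩) =
        ((σ e).att x).map fun u => Quot.mk _ (Sum.inr ⟨e, u⟩) := rfl
      refine ((congrArg (List.map _) (sa e x)).trans List.map_map).trans ?_
      rw [h, List.map_map]
      rfl
  · rintro (e | ⟨e, x⟩)
    · exact hl e
    · exact sl e x
  · simp only [List.map_map, ← hx]
    rfl

theorem Iso.replace_congr {H : HGraph ty} {B : Set H.E} {σ σ' : B → HGraph ty}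
    (hσ : ∀ e : B, (σ e).Iso (σ' e)) : (H.replace B σ).Iso (H.replace B σ') :=
  CrossIso.replace (gV := Equiv.refl _) (gE := Equiv.refl _) (by simp) (by simp) (by simp)
    (by simp) hσ

/-- Replacing no hyperedge changes nothing. -/
theorem replace_empty_iso (H : HGraph ty) (σ : (∅ : Set H.E) → HGraph ty) :
    (H.replace ∅ σ).Iso H := by
  refine CrossIso.of_replace (K := H) id (fun e => e.2.elim) (fun v => Quot.mk _ (Sum.inl v))
    (fun e => e.2.elim) (fun _ => rfl) (fun e => e.2.elim) (fun y => Or.inl ⟨y, rfl⟩)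
    (Sum.elim (fun e => e.1) fun p => p.1.2.elim) ⟨?_, ?_⟩ ?_ (fun e => e.2.elim) ?_
    (fun e => e.2.elim) (by simp)
  · rintro (e | p) (e' | p') h
    · simpa [Subtype.ext_iff] using h
    · exact p'.1.2.elim
    · exact p.1.2.elim
    · exact p.1.2.elim
  · exact fun e => ⟨Sum.inl ⟨e, id⟩, rfl⟩
  · simp
  · simp

/-- Inserting handles for all hyperedges outside `B` has no effect. -/
theorem replace_univ_iso (H : HGraph ty) (B : Set H.E) (σ : H.E → HGraph ty)
    (hσ : ∀ e ∉ B, (σ e).Iso (handle ty (H.lab e))) :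
    (H.replace Set.univ fun e => σ e).Iso (H.replace B fun e => σ e) := by
  classical
  choose sV sE sa sl sx using hσ
  have ext_eq : ∀ e (he : e ∉ B), (σ e).ext =
      (List.finRange (ty (H.lab e))).map (sV e he).symm := by
    intro e he
    rw [← (List.map_injective_iff.2 (sV e he).injective).eq_iff, sx]
    simp
  have att_eq : ∀ e (he : e ∉ B) x, (σ e).att x = (σ e).ext := by
    intro e he x
    rw [← (List.map_injective_iff.2 (sV e he).injective).eq_iff, sx, ← sa]
  let Q := Quot (Glue H B fun e => σ e)
  let f : H.V → Q := fun v => Quot.mk _ (Sum.inl v)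
  let g : ∀ e : (Set.univ : Set H.E), (σ e).V → Q := fun e u =>
    if he : e.1 ∈ B then Quot.mk _ (Sum.inr ⟨⟨e.1, he⟩, u⟩)
    else Quot.mk _ (Sum.inl ((H.att e.1).get ((sV e.1 he u).cast (H.att_length _).symm)))
  have g_ext : ∀ (e : (Set.univ : Set H.E)), e.1 ∉ B → (σ e).ext.map (g e) = (H.att e).map f := by
    intro e he
    rw [ext_eq e.1 he]
    refine List.ext_getElem (by simp [H.att_length]) fun i h1 h2 => ?_
    simp [g, he, f]
  refine CrossIso.of_replace (K := H.replace B fun e => σ e) f g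
    (Quot.lift (Sum.elim (fun v => Quot.mk _ (Sum.inl v))
      fun p => Quot.mk _ (Sum.inr ⟨⟨p.1.1, trivial⟩, p.2⟩)) ?_)
    ?_ ?_ ?_ ?_
    (Sum.elim (fun e => (e.2 trivial).elim) fun p =>
      if he : p.1.1 ∈ B then Sum.inr ⟨⟨p.1.1, he⟩, p.2⟩ else Sum.inl ⟨p.1.1, he⟩)
    ⟨?_, ?_⟩ ?_ ?_ ?_ ?_ ?_
  · rintro _ _ ⟨e, i, v, u, hv, hu⟩
    exact glue_sound (B := Set.univ) (e := ⟨e.1, trivial⟩) hv hu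
  · intro e i v u hv hu
    by_cases he : e.1 ∈ B
    · simp only [g, he, dif_pos]
      exact glue_sound (B := B) (σ := fun e => σ e) (e := ⟨e.1, he⟩) hv hu
    · have h := congrArg (fun l : List Q => l[i]?) (g_ext e he)
      simp only [List.getElem?_map, hv, hu, Option.map_some] at h
      exact (Option.some.inj h).symm
  · intro v; rfl
  · intro e u
    by_cases he : e.1 ∈ B
    · simp only [g, he, dif_pos]; rfl
    · simp only [g, he, dif_neg, not_false_iff]
      refine glue_sound (B := Set.univ) (e := e) (i := (sV e.1 he u).1) ?_ ?_
      · simp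
      · rw [ext_eq e.1 he]
        simp
  · rintro ⟨v | ⟨e, u⟩⟩
    · exact Or.inl ⟨v, rfl⟩
    · exact Or.inr ⟨⟨e.1, trivial⟩, u, by simp [g]⟩
  · rintro (e | ⟨⟨e, _⟩, x⟩) (e' | ⟨⟨e', _⟩, x'⟩) h
    · exact (e.2 trivial).elim
    · exact (e.2 trivial).elim
    · exact (e'.2 trivial).elim
    · by_cases he : e ∈ B <;> by_cases he' : e' ∈ B
      · simp only [Sum.elim_inr, he, he', dif_pos, Sum.inr.injEq] at h
        cases h; rfl
      · simp [he, he'] at h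
      · simp [he, he'] at h
      · simp only [Sum.elim_inr, he, he', dif_neg, not_false_iff, Sum.inl.injEq,
          Subtype.mk.injEq] at h
        subst h
        rw [(sE e he).injective (Subsingleton.elim (sE e he x) (sE e he x'))]
  · rintro (⟨e, he⟩ | ⟨⟨e, he⟩, x⟩)
    · exact ⟨Sum.inr ⟨⟨e, trivial⟩, (sE e he).symm ()⟩, by simp [he]⟩
    · exact ⟨Sum.inr ⟨⟨e, trivial⟩, x⟩, by simp [he]⟩
  · exact fun e => (e.2 trivial).elim
  · intro e x
    by_cases he : e.1 ∈ B
    · simp [he, g]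
    · rw [att_eq e.1 he x, g_ext e he]
      simp [he, f]
  · exact fun e => (e.2 trivial).elim
  · intro e x
    by_cases he : e.1 ∈ B
    · simp [he]
    · simp [he, ← sl e.1 he x]
  · rfl

/-- Replacing one further hyperedge after those in `B` is replacing them all at once. -/
theorem replace_replace_iso (H : HGraph ty) (B : Set H.E) (σ : H.E → HGraph ty) (e : H.E)
    (he : e ∉ B) :
    ((H.replace B fun e => σ e).replace {Sum.inl ⟨e, he⟩} fun _ => σ e).Iso
      (H.replace (insert e B) fun e => σ e) := by
  classical
  let K := H.replace B fun e => σ e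
  let Q := Quot (Glue H (insert e B) fun e => σ e)
  refine CrossIso.of_replace (H := K) (K := H.replace (insert e B) fun e => σ e)
    (B := {Sum.inl ⟨e, he⟩}) (σ := fun _ => σ e)
    (Quot.lift (Sum.elim (fun v => Quot.mk _ (Sum.inl v))
      fun p => Quot.mk _ (Sum.inr ⟨⟨p.1.1, Or.inr p.1.2⟩, p.2⟩)) ?_)
    (fun _ u => Quot.mk _ (Sum.inr ⟨⟨e, Or.inl rfl⟩, u⟩))
    (Quot.lift (Sum.elim (fun v => Quot.mk _ (Sum.inl (Quot.mk _ (Sum.inl v))))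
      fun p => if h : p.1.1 = e then Quot.mk _ (Sum.inr ⟨⟨Sum.inl ⟨e, he⟩, Set.mem_singleton _⟩, h ▸ p.2⟩)
        else Quot.mk _ (Sum.inl (Quot.mk _ (Sum.inr ⟨⟨p.1.1, p.1.2.resolve_left h⟩, p.2⟩)))) ?_)
    ?_ ?_ ?_ ?_
    (Sum.elim (fun x => match x with
        | ⟨Sum.inl x, hx⟩ => Sum.inl ⟨x.1, fun h => h.elim
            (fun h => hx (by rw [Set.mem_singleton_iff]; congr; exact Subtype.ext h)) x.2⟩
        | ⟨Sum.inr p, _⟩ => Sum.inr ⟨⟨p.1.1, Or.inr p.1.2⟩, p.2⟩)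
      fun p => Sum.inr ⟨⟨e, Or.inl rfl⟩, p.2⟩)
    ⟨?_, ?_⟩ ?_ ?_ ?_ ?_ ?_
  · rintro _ _ ⟨e', i, v, u, hv, hu⟩
    exact glue_sound (B := insert e B) (e := ⟨e'.1, Or.inr e'.2⟩) hv hu
  · rintro _ _ ⟨⟨e', h'⟩, i, v, u, hv, hu⟩
    by_cases h : e' = e
    · subst h
      simp only [Sum.elim_inl, Sum.elim_inr, dif_pos]
      refine glue_sound (H := K) (B := {Sum.inl ⟨e', he⟩}) (σ := fun _ => σ e')
        (e := ⟨Sum.inl ⟨e', he⟩, Set.mem_singleton _⟩) (i := i) ?_ hu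
      simp only at hv
      simp [K, hv]
    · simp only [Sum.elim_inl, Sum.elim_inr, h, dif_neg, not_false_iff]
      congr 2
      exact glue_sound (B := B) (σ := fun e => σ e) (e := ⟨e', h'.resolve_left h⟩) hv hu
  · rintro ⟨x, hx⟩ i v u hv hu
    rw [Set.mem_singleton_iff] at hx
    subst hx
    simp only [K, List.getElem?_map, Option.map_eq_some_iff] at hv
    obtain ⟨v, hv, rfl⟩ := hv
    exact glue_sound (B := insert e B) (σ := fun e => σ e) (e := ⟨e, Or.inl rfl⟩) hv hu
  · rintro ⟨v | ⟨e', u⟩⟩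
    · rfl
    · have : e'.1 ≠ e := fun h => he (h ▸ e'.2)
      simp only [Sum.elim_inr, this, dif_neg, not_false_iff]
  · rintro ⟨x, hx⟩ u
    rw [Set.mem_singleton_iff] at hx
    subst hx
    simp
  · rintro ⟨v | ⟨⟨e', h'⟩, u⟩⟩
    · exact Or.inl ⟨Quot.mk _ (Sum.inl v), rfl⟩
    · by_cases h : e' = e
      · subst h
        exact Or.inr ⟨⟨Sum.inl ⟨e', he⟩, Set.mem_singleton _⟩, u, rfl⟩
      · exact Or.inl ⟨Quot.mk _ (Sum.inr ⟨⟨e', h'.resolve_left h⟩, u⟩), rfl⟩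
  · rintro (⟨x | p, hx⟩ | ⟨⟨_, rfl⟩, x⟩) (⟨x' | p', hx'⟩ | ⟨⟨_, rfl⟩, x'⟩) h
    · simp only [Sum.elim_inl, Sum.inl.injEq, Subtype.mk.injEq] at h
      congr 3
      exact Subtype.ext h
    · simp at h
    · simp at h
    · simp at h
    · obtain ⟨⟨p, hp⟩, u⟩ := p
      obtain ⟨⟨p', hp'⟩, u'⟩ := p'
      simp only [Sum.elim_inl, Sum.inr.injEq] at h
      cases h; rfl
    · obtain ⟨⟨p, hp⟩, u⟩ := p
      simp only [Sum.elim_inl, Sum.elim_inr, Sum.inr.injEq] at h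
      cases h; exact (he hp).elim
    · simp at h
    · obtain ⟨⟨p, hp⟩, u⟩ := p'
      simp only [Sum.elim_inl, Sum.elim_inr, Sum.inr.injEq] at h
      cases h; exact (he hp).elim
    · simp only [Sum.elim_inr, Sum.inr.injEq] at h
      cases h; rfl
  · rintro (⟨x, hx⟩ | ⟨⟨e', h'⟩, x⟩)
    · refine ⟨Sum.inl ⟨Sum.inl ⟨x, fun h => hx (Or.inr h)⟩, fun h => hx ?_⟩, rfl⟩
      rw [Set.mem_singleton_iff, Sum.inl.injEq, Subtype.mk.injEq] at h
      exact Or.inl h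
    · by_cases h : e' = e
      · subst h
        exact ⟨Sum.inr ⟨⟨Sum.inl ⟨e', he⟩, Set.mem_singleton _⟩, x⟩, rfl⟩
      · exact ⟨Sum.inl ⟨Sum.inr ⟨⟨e', h'.resolve_left h⟩, x⟩, by simp⟩, rfl⟩
  · rintro ⟨x | p, hx⟩ <;> simp [K]
  · rintro ⟨_, rfl⟩ x
    simp
  · rintro ⟨x | p, hx⟩ <;> rfl
  · rintro ⟨_, rfl⟩ x
    rfl
  · simp [K]

end HGraph


/-! ### Sequential and parallel derivations -/

namespace HGraph

variable {Lab : Type} {ty ty' : Lab → ℕ}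

theorem Represents.ty_lab {H : HGraph ty} {w : List Lab} (h : H.Represents w) (e : H.E) :
    ty (H.lab e) = 2 := by
  obtain ⟨hw, gV, gE, ha, hl, hx⟩ := h
  rw [← hl]
  exact hw _ (List.get_mem w _)

theorem Represents.exists_lab_eq {H : HGraph ty} {w : List Lab} (h : H.Represents w) {a : Lab}
    (ha : a ∈ w) : ∃ e, H.lab e = a := by
  obtain ⟨hw, gV, gE, _, hl, hx⟩ := h
  obtain ⟨i, hi⟩ := List.get_of_mem ha
  refine ⟨gE.symm i, ?_⟩
  rw [← hl, gE.apply_symm_apply]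
  exact hi

theorem Represents.of_crossIso {H : HGraph ty} {K : HGraph ty'} {w : List Lab}
    (h : H.Represents w) (i : CrossIso H K) (hw' : ∀ a ∈ w, ty' a = 2) : K.Represents w := by
  obtain ⟨hw, j⟩ := h
  refine ⟨hw', i.symm.trans (CrossIso.trans j ?_)⟩
  exact ⟨Equiv.refl _, Equiv.refl _, by simp, by simp, by simp⟩

theorem crossIso_handle {X : Lab} (h : ty' X = ty X) : CrossIso (handle ty X) (handle ty' X) := by
  refine ⟨finCongr h.symm, Equiv.refl _, fun e => ?_, fun e => rfl, ?_⟩ <;>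
    exact List.ext_getElem (by simp [h]) (by simp)

/-- A hypergraph regarded over another typing that agrees on the occurring labels. -/
def retype (ty' : Lab → ℕ) (H : HGraph ty) (h : ∀ e, ty' (H.lab e) = ty (H.lab e)) :
    HGraph ty' where
  V := H.V
  E := H.E
  finite_V := H.finite_V
  finite_E := H.finite_E
  att := H.att
  lab := H.lab
  ext := H.ext
  att_length e := (H.att_length e).trans (h e).symm

theorem crossIso_retype (H : HGraph ty) (h : ∀ e, ty' (H.lab e) = ty (H.lab e)) :
    CrossIso H (H.retype ty' h) :=
  ⟨Equiv.refl H.V, Equiv.refl H.E, fun _ => (List.map_id _).symm, fun _ => rfl, List.map_id _⟩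

/-- A single replacement can be transported along an isomorphism. -/
theorem CrossIso.exists_replace_singleton {H : HGraph ty} {K : HGraph ty'} (i : CrossIso H K)
    (e : H.E) {R : HGraph ty} {R' : HGraph ty'} (j : CrossIso R R') :
    ∃ e' : K.E, K.lab e' = H.lab e ∧
      CrossIso (H.replace {e} fun _ => R) (K.replace {e'} fun _ => R') := by
  obtain ⟨gV, gE, ha, hl, hx⟩ := i
  exact ⟨gE e, hl e, CrossIso.replace ha hl hx (by simp) fun _ => j⟩

end HGraph

section

variable {Lab : Type} {ty ty' : Lab → ℕ}

open HGraph

theorem DirectlyDerives.of_iso_left {R : Set (HyperRule ty)} {H H₀ H' : HGraph ty}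
    (h : DirectlyDerives R H H') (i : H.Iso H₀) : DirectlyDerives R H₀ H' := by
  obtain ⟨e, r, hr, hlab, j⟩ := h
  obtain ⟨e', he', j'⟩ := CrossIso.exists_replace_singleton i e (CrossIso.refl r.rhs)
  exact ⟨e', r, hr, hlab.trans he'.symm, j.trans j'⟩

theorem DirectlyDerives.of_iso_right {R : Set (HyperRule ty)} {H H₀ H' : HGraph ty}
    (h : DirectlyDerives R H H') (i : H'.Iso H₀) : DirectlyDerives R H H₀ := by
  obtain ⟨e, r, hr, hlab, j⟩ := h
  exact ⟨e, r, hr, hlab, i.symm.trans j⟩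

theorem Derives.of_iso_right {R : Set (HyperRule ty)} {H H₀ H' : HGraph ty}
    (h : Derives R H H') (i : H'.Iso H₀) : Derives R H H₀ := by
  rcases h with h | h
  · obtain ⟨X, hX, hstep⟩ := Relation.TransGen.tail'_iff.1 h
    exact Or.inl (Relation.TransGen.tail' hX (hstep.of_iso_right i))
  · exact Or.inr (h.trans i)

theorem Derives.tail {R : Set (HyperRule ty)} {H H₀ H' : HGraph ty}
    (h : Derives R H H₀) (h' : DirectlyDerives R H₀ H') : Derives R H H' := by
  rcases h with h | h
  · exact Or.inl (h.tail h')
  · exact Or.inl (Relation.TransGen.single (h'.of_iso_left h.symm))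

theorem Derives.head {R : Set (HyperRule ty)} {H H₀ H' : HGraph ty}
    (h : DirectlyDerives R H H₀) (h' : Derives R H₀ H') : Derives R H H' := by
  rcases h' with h' | h'
  · exact Or.inl (h'.head h)
  · exact Or.inl (Relation.TransGen.single (h.of_iso_right h'))

theorem Derives.trans {R : Set (HyperRule ty)} {H H₀ H' : HGraph ty}
    (h : Derives R H H₀) (h' : Derives R H₀ H') : Derives R H H' := by
  rcases h' with h' | h'
  · induction h' with
    | single h' => exact h.tail h'
    | tail _ h' ih => exact ih.tail h'
  · exact h.of_iso_right h'

/-- Induction along a parallel derivation, for a property that respects isomorphism. -/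
theorem ParallelDerives.induction {I : Type} {T : I → Set (HyperRule ty)} {H H' : HGraph ty}
    {P : HGraph ty → Prop} (h : ParallelDerives T H H')
    (iso : ∀ G G' : HGraph ty, G.Iso G' → P G → P G') (base : P H)
    (step : ∀ (i : I) (G : HGraph ty) (ρ : G.E → HyperRule ty),
      (∀ e, ρ e ∈ T i ∧ (ρ e).lhs = G.lab e) → P G →
        P (G.replace Set.univ fun e => (ρ e).rhs)) : P H' := by
  have key : ∀ G G', (∃ i, ParallelDirectlyDerives (T i) G G') → P G → P G' := by
    rintro G G' ⟨i, ρ, hρ, hiso⟩ hG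
    exact iso _ _ hiso.symm (step i G ρ hρ hG)
  rcases h with h | h
  · induction h with
    | single h => exact key _ _ h base
    | tail _ h ih => exact key _ _ h ih
  · exact iso _ _ h base

/-- The rule replacing `X` by its own handle. -/
abbrev identityRule (ty : Lab → ℕ) (X : Lab) : HyperRule ty where
  lhs := X
  rhs := handle ty X
  type_eq := List.length_finRange.symm

/-- A rule set with all identity rules added, so that parallel steps may leave any hyperedge
untouched. -/
def withIdentities (R : Set (HyperRule ty)) : Set (HyperRule ty) :=
  R ∪ Set.range (identityRule ty)

theorem isTable_withIdentities [Finite Lab] {R : Set (HyperRule ty)} (hR : R.Finite) :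
    IsTable (withIdentities R) :=
  ⟨hR.union (Set.finite_range _), fun X => ⟨identityRule ty X, Or.inr ⟨X, rfl⟩, rfl⟩⟩

theorem DirectlyDerives.parallel {R : Set (HyperRule ty)} {H H' : HGraph ty}
    (h : DirectlyDerives R H H') : ParallelDirectlyDerives (withIdentities R) H H' := by
  classical
  obtain ⟨e, r, hr, hlab, i⟩ := h
  refine ⟨fun f => if f = e then r else identityRule ty (H.lab f), fun f => ?_, i.trans ?_⟩
  · by_cases hf : f = e
    · simp only [hf, if_true]
      exact ⟨Or.inl hr, hlab⟩
    · simp only [hf, if_false]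
      exact ⟨Or.inr ⟨_, rfl⟩, trivial⟩
  · refine Iso.symm (Iso.trans (replace_univ_iso H {e}
      (fun f => (if f = e then r else identityRule ty (H.lab f)).rhs) fun f hf => ?_)
      (Iso.replace_congr fun f => ?_))
    · rw [Set.mem_singleton_iff] at hf
      simp only [hf, if_false]
      exact Iso.refl _
    · have : (f : H.E) = e := f.2
      simp only [this, if_true]
      exact Iso.refl _

theorem ParallelDirectlyDerives.derives {R : Set (HyperRule ty)} {H H' : HGraph ty}
    (h : ParallelDirectlyDerives (withIdentities R) H H') : Derives R H H' := by
  obtain ⟨ρ, hρ, i⟩ := h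
  -- the hyperedges that are properly rewritten are treated one after the other
  have key : ∀ B : Set H.E, B.Finite → (∀ e ∈ B, ρ e ∈ R) →
      Derives R H (H.replace B fun e => (ρ e).rhs) := by
    intro B hB
    induction B, hB using Set.Finite.induction_on with
    | empty => exact fun _ => Or.inr (replace_empty_iso H _).symm
    | @insert e B he _ ih =>
      intro hR
      refine (ih fun f hf => hR f (Or.inr hf)).tail ?_
      exact ⟨Sum.inl ⟨e, he⟩, ρ e, hR e (Or.inl rfl), (hρ e).2,
        (replace_replace_iso H B (fun e => (ρ e).rhs) e he).symm⟩
  refine (key {e | ρ e ∈ R} (Set.toFinite _) fun e he => he).of_iso_right ?_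
  refine (i.trans (replace_univ_iso H _ (fun e => (ρ e).rhs) fun e he => ?_)).symm
  rcases (hρ e).1 with h | ⟨X, hX⟩
  · exact (he h).elim
  · rw [← (hρ e).2, ← hX]
    exact Iso.refl _

theorem parallelDerives_withIdentities_iff {R : Set (HyperRule ty)} {H H' : HGraph ty} :
    ParallelDerives (fun _ : Unit => withIdentities R) H H' ↔ Derives R H H' := by
  constructor
  · rintro (h | h)
    · induction h with
      | single h => exact h.choose_spec.derives
      | tail _ h ih => exact ih.trans h.choose_spec.derives
    · exact Or.inr h
  · rintro (h | h)
    · exact Or.inl (Relation.TransGen.mono (fun _ _ h => ⟨(), h.parallel⟩) _ _ h)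
    · exact Or.inr h

end

/-! ### Hyperedge replacement grammars as parallel grammars -/

section

variable {Lab : Type} {ty : Lab → ℕ}

open HGraph

/-- The rules that are meaningful for the typing `ty'`, regarded over `ty'`. -/
def retypedRules (ty' : Lab → ℕ) (R : Set (HyperRule ty)) : Set (HyperRule ty') :=
  ⋃ r ∈ R, {r' | ∃ (hl : ty' r.lhs = ty r.lhs) (h : ∀ e, ty' (r.rhs.lab e) = ty (r.rhs.lab e)),
    r' = ⟨r.lhs, r.rhs.retype ty' h, hl.trans r.type_eq⟩}

theorem finite_retypedRules (ty' : Lab → ℕ) {R : Set (HyperRule ty)} (hR : R.Finite) :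
    (retypedRules ty' R).Finite := by
  refine hR.biUnion fun r _ => Set.Subsingleton.finite ?_
  rintro _ ⟨hl, h, rfl⟩ _ ⟨hl', h', rfl⟩
  rfl

theorem exists_of_mem_retypedRules {ty' : Lab → ℕ} {R : Set (HyperRule ty)} {r' : HyperRule ty'}
    (h : r' ∈ retypedRules ty' R) :
    ∃ r ∈ R, r'.lhs = r.lhs ∧ CrossIso r.rhs r'.rhs ∧ r'.rhs.RepetitionFree = r.rhs.RepetitionFree ∧
      ty' r'.lhs = ty r.lhs := by
  simp only [retypedRules, Set.mem_iUnion] at h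
  obtain ⟨r, hr, hl, h, rfl⟩ := h
  exact ⟨r, hr, rfl, crossIso_retype _ h, rfl, hl⟩

theorem Derives.of_retypedRules {ty' : Lab → ℕ} {R : Set (HyperRule ty)} {H : HGraph ty}
    {K K' : HGraph ty'} (h : Derives (retypedRules ty' R) K K') (i : CrossIso H K) :
    ∃ H', Derives R H H' ∧ CrossIso H' K' := by
  rcases h with h | h
  · have key : ∀ {K K' : HGraph ty'} {H : HGraph ty},
        DirectlyDerives (retypedRules ty' R) K K' → CrossIso H K →
        ∃ H', DirectlyDerives R H H' ∧ CrossIso H' K' := by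
      rintro K K' H ⟨e, r', hr', hlab, j⟩ i
      obtain ⟨r, hr, hlhs, hrhs, -⟩ := exists_of_mem_retypedRules hr'
      obtain ⟨e', he', i'⟩ := i.symm.exists_replace_singleton e hrhs.symm
      exact ⟨_, ⟨e', r, hr, hlhs.symm.trans (hlab.trans he'.symm), Iso.refl _⟩,
        (CrossIso.trans j i').symm⟩
    induction h with
    | single h =>
      obtain ⟨H', h', i'⟩ := key h i
      exact ⟨H', Or.inl (Relation.TransGen.single h'), i'⟩
    | tail _ h ih =>
      obtain ⟨H', h', i'⟩ := ih
      obtain ⟨H'', h'', i''⟩ := key h i'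
      exact ⟨H'', h'.tail h'', i''⟩
  · exact ⟨H, Or.inr (Iso.refl H), i.trans h⟩

/-- Rules of type at most `k` can only remove labels of type at most `k`. -/
theorem DirectlyDerives.ty_le_of_ty_le {R : Set (HyperRule ty)} {H H' : HGraph ty} {k : ℕ}
    (h : DirectlyDerives R H H') (hR : ∀ r ∈ R, ty r.lhs ≤ k) (hH' : ∀ e, ty (H'.lab e) ≤ k) :
    ∀ e, ty (H.lab e) ≤ k := by
  obtain ⟨e, r, hr, hlab, gV, gE, -, hl, -⟩ := h
  intro f
  by_cases hf : f = e
  · rw [hf, ← hlab]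
    exact hR r hr
  · have := hl (gE.symm (Sum.inl ⟨f, hf⟩))
    rw [gE.apply_symm_apply] at this
    exact (congrArg ty this).le.trans (hH' _)

theorem Derives.exists_retypedRules {ty' : Lab → ℕ} {R : Set (HyperRule ty)} {H H' : HGraph ty} {k : ℕ}
    (h : Derives R H H') (hty : ∀ X, ty X ≤ k → ty' X = ty X) (hR : ∀ r ∈ R, ty r.lhs ≤ k)
    (hH' : ∀ e, ty (H'.lab e) ≤ k) {K : HGraph ty'} (i : CrossIso H K) :
    ∃ K', Derives (retypedRules ty' R) K K' ∧ CrossIso H' K' := by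
  rcases h with h | h
  · have key : ∀ {H H' : HGraph ty} {K : HGraph ty'}, DirectlyDerives R H H' →
        (∀ e, ty (H'.lab e) ≤ k) → CrossIso H K →
        ∃ K', DirectlyDerives (retypedRules ty' R) K K' ∧ CrossIso H' K' := by
      rintro H H' K ⟨e, r, hr, hlab, j⟩ hH' i
      have hl : ty' r.lhs = ty r.lhs := hty _ (hR r hr)
      have hrhs : ∀ x, ty' (r.rhs.lab x) = ty (r.rhs.lab x) := by
        obtain ⟨gV, gE, -, hl, -⟩ := j
        intro x
        have := hl (gE.symm (Sum.inr ⟨⟨e, rfl⟩, x⟩))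
        rw [gE.apply_symm_apply] at this
        exact hty _ ((congrArg ty this).le.trans (hH' _))
      obtain ⟨e', he', i'⟩ := i.exists_replace_singleton e (crossIso_retype r.rhs hrhs)
      refine ⟨_, ⟨e', ⟨r.lhs, r.rhs.retype ty' hrhs, hl.trans r.type_eq⟩, ?_,
        hlab.trans he'.symm, Iso.refl _⟩, CrossIso.trans j i'⟩
      simp only [retypedRules, Set.mem_iUnion]
      exact ⟨r, hr, hl, hrhs, rfl⟩
    suffices hs : (∀ e, ty (H.lab e) ≤ k) ∧ ∀ {K : HGraph ty'}, CrossIso H K →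
        ∃ K', Derives (retypedRules ty' R) K K' ∧ CrossIso H' K' from hs.2 i
    clear i K
    induction h using Relation.TransGen.head_induction_on with
    | single h =>
      refine ⟨h.ty_le_of_ty_le hR hH', fun i => ?_⟩
      obtain ⟨K', h', i'⟩ := key h hH' i
      exact ⟨K', Or.inl (Relation.TransGen.single h'), i'⟩
    | head h _ ih =>
      refine ⟨h.ty_le_of_ty_le hR ih.1, fun i => ?_⟩
      obtain ⟨K₁, h₁, i₁⟩ := key h ih.1 i
      obtain ⟨K', h', i'⟩ := ih.2 i₁
      exact ⟨K', Derives.head h₁ h', i'⟩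
  · exact ⟨K, Or.inr (Iso.refl K), (CrossIso.symm h).trans i⟩

end

/-- Adding the identity rules turns a hyperedge replacement grammar into a parallel one.
Labels of type above `k` cannot contribute to string graphs; they are retyped, and the rules
containing them dropped, so that all identity rules have type at most `k`. -/
theorem repetitionFreeHRS_subset_repetitionFreePHRS (A : Type*) {k : ℕ} (hk : 2 ≤ k) :
    RepetitionFreeHRS A k ⊆ RepetitionFreePHRS A k := by
  classical
  rintro L ⟨G, ι, hord, hrf, hstr, hL⟩
  have := G.finite_Lab
  let ty' : G.Lab → ℕ := fun X => if G.ty X ≤ k then G.ty X else 2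
  have hty : ∀ X, G.ty X ≤ k → ty' X = G.ty X := fun X hX => if_pos hX
  have hty' : ∀ X, ty' X ≤ k := fun X => by
    by_cases h : G.ty X ≤ k <;> simp [ty', h, hk]
  let G' : PHRGrammar :=
    { Lab := G.Lab
      finite_Lab := G.finite_Lab
      ty := ty'
      terminals := G.nonterminalsᶜ
      start := G.start
      I := Unit
      finite_I := inferInstance
      nonempty_I := inferInstance
      tables := fun _ => withIdentities (retypedRules ty' G.rules)
      isTable := fun _ => isTable_withIdentities (finite_retypedRules ty' G.finite_rules) }
  have hlang : ∀ K, K ∈ G'.language ↔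
      Derives (retypedRules ty' G.rules) (HGraph.handle ty' G.start) K ∧
        ∀ e, K.lab e ∉ G.nonterminals := fun K =>
    and_congr_left fun _ => parallelDerives_withIdentities_iff
  refine ⟨G', ι, fun _ r _ => hty' _, ?_, ?_⟩
  · rintro _ r (hr | ⟨X, rfl⟩)
    · obtain ⟨r₀, hr₀, -, -, h, -⟩ := exists_of_mem_retypedRules hr
      rw [h]
      exact hrf r₀ hr₀
    · exact List.nodup_finRange _
  by_cases hS : G.ty G.start ≤ k
  · have hlang' : ∀ K, K ∈ G'.language ↔ ∃ H ∈ G.language, HGraph.CrossIso H K := by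
      intro K
      rw [hlang]
      constructor
      · rintro ⟨hK, hterm⟩
        obtain ⟨H, hH, i⟩ := hK.of_retypedRules (HGraph.crossIso_handle (hty _ hS))
        refine ⟨H, ⟨hH, fun e => ?_⟩, i⟩
        obtain ⟨gV, gE, -, hl, -⟩ := i
        rw [← hl]
        exact hterm _
      · rintro ⟨H, hH, i⟩
        obtain ⟨w, hw⟩ := hstr H hH
        obtain ⟨K', hK', i'⟩ := hH.1.exists_retypedRules hty hord
          (fun e => (hw.ty_lab e).le.trans hk) (HGraph.crossIso_handle (hty _ hS))
        refine ⟨hK'.of_iso_right (i'.symm.trans i), fun e => ?_⟩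
        obtain ⟨gV, gE, -, hl, -⟩ := i.symm
        rw [← hl]
        exact hH.2 _
    have hty2 : ∀ X, G.ty X = 2 → ty' X = 2 := fun X hX => by rw [hty X (hX ▸ hk), hX]
    refine ⟨fun K hK => ?_, ?_⟩
    · obtain ⟨H, hH, i⟩ := (hlang' K).1 hK
      obtain ⟨w, hw⟩ := hstr H hH
      exact ⟨w, hw.of_crossIso i fun a ha => hty2 a (hw.choose a ha)⟩
    · rw [← hL]
      ext w
      constructor
      · rintro ⟨K, hK, hw⟩
        obtain ⟨H, hH, i⟩ := (hlang' K).1 hK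
        obtain ⟨w', hw'⟩ := hstr H hH
        refine ⟨H, hH, hw.of_crossIso i.symm fun a ha => ?_⟩
        obtain ⟨e, rfl⟩ := hw.exists_lab_eq ha
        obtain ⟨gV, gE, -, hl, -⟩ := i.symm
        rw [← hl]
        exact hw'.ty_lab _
      · rintro ⟨H, hH, hw⟩
        have hw2 : ∀ a ∈ w, ty' a = 2 := fun a ha => hty2 a (hw.choose a ha)
        have i : HGraph.CrossIso H (HGraph.stringGraph w hw2) :=
          HGraph.CrossIso.trans hw.choose_spec
            ⟨Equiv.refl _, Equiv.refl _, by simp, by simp, by simp⟩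
        exact ⟨_, (hlang' _).2 ⟨H, hH, i⟩, hw2, HGraph.Iso.refl _⟩
  · -- a start symbol of too large a type admits no derivation step in either grammar
    have h0 : G.language = ∅ := by
      refine Set.eq_empty_of_forall_notMem ?_
      rintro H ⟨h | h, hterm⟩
      · obtain ⟨X, ⟨e, r, hr, hlab, -⟩, -⟩ := Relation.TransGen.head'_iff.1 h
        have hlab' : r.lhs = G.start := hlab
        exact hS (hlab' ▸ hord r hr)
      · obtain ⟨gV, gE, -, hl, -⟩ := h
        exact hterm (gE ()) (by rw [hl]; exact G.start_mem)
    have h0' : G'.language = ∅ := by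
      refine Set.eq_empty_of_forall_notMem fun K hK => ?_
      obtain ⟨h | h, hterm⟩ := (hlang K).1 hK
      · obtain ⟨X, ⟨e, r, hr, hlab, -⟩, -⟩ := Relation.TransGen.head'_iff.1 h
        obtain ⟨r₀, hr₀, hlhs, -⟩ := exists_of_mem_retypedRules hr
        have : r₀.lhs = G.start := hlhs.symm.trans hlab
        exact hS (this ▸ hord r₀ hr₀)
      · obtain ⟨gV, gE, -, hl, -⟩ := h
        exact hterm (gE ()) (by rw [hl]; exact G.start_mem)
    rw [h0] at hL
    rw [h0']
    refine ⟨fun H hH => hH.elim, ?_⟩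
    rw [← hL]
    ext w
    simp [STR]


/-! ### Numbers of hyperedges generated by sequential grammars -/

section FiniteSums

variable {α : Type} [Finite α]

theorem finsum_nat_eq_add_compl (n : α → ℕ) (a : α) :
    ∑ᶠ x, n x = n a + ∑ᶠ x : {x // x ∉ ({a} : Set α)}, n x := by
  classical
  let _ := Fintype.ofFinite α
  let _ := Fintype.ofFinite {x // x ∉ ({a} : Set α)}
  rw [finsum_eq_sum_of_fintype, finsum_eq_sum_of_fintype, ← Finset.add_sum_erase _ _ (Finset.mem_univ a)]
  congr 1
  exact (Finset.sum_subtype _ (by simp) _)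

theorem finsum_nat_update (n : α → ℕ) (a : α) (v : ℕ) [DecidableEq α] :
    ∑ᶠ x, Function.update n a v x = v + ∑ᶠ x : {x // x ∉ ({a} : Set α)}, n x := by
  rw [finsum_nat_eq_add_compl _ a, Function.update_self]
  congr 1
  refine finsum_congr fun x => ?_
  rw [Function.update_of_ne x.2]

theorem finsum_nat_le_mul {n : α → ℕ} {b : ℕ} (h : ∀ x, n x ≤ b) :
    ∑ᶠ x, n x ≤ Nat.card α * b := by
  let _ := Fintype.ofFinite α
  rw [finsum_eq_sum_of_fintype, Nat.card_eq_fintype_card]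
  exact (Finset.sum_le_card_nsmul _ _ b fun x _ => h x).trans (by simp)

theorem finsum_nat_one : ∑ᶠ _ : α, 1 = Nat.card α := by
  let _ := Fintype.ofFinite α
  rw [finsum_eq_sum_of_fintype, Nat.card_eq_fintype_card]
  simp

theorem finsum_nat_sum {β : Type} [Finite β] (n : α ⊕ β → ℕ) :
    ∑ᶠ x, n x = ∑ᶠ x, n (Sum.inl x) + ∑ᶠ x, n (Sum.inr x) := by
  let _ := Fintype.ofFinite α
  let _ := Fintype.ofFinite β
  rw [finsum_eq_sum_of_fintype, finsum_eq_sum_of_fintype, finsum_eq_sum_of_fintype,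
    Fintype.sum_sum_type]

theorem finsum_nat_sigma {β : α → Type} [∀ a, Finite (β a)] (n : (Σ a, β a) → ℕ) :
    ∑ᶠ x, n x = ∑ᶠ a, ∑ᶠ b, n ⟨a, b⟩ := by
  let _ := Fintype.ofFinite α
  let _ := fun a => Fintype.ofFinite (β a)
  simp only [finsum_eq_sum_of_fintype]
  exact Fintype.sum_sigma _

end FiniteSums

section Counting

variable {Lab : Type} {ty : Lab → ℕ}

/-- `Count R N X n k`: some derivation tree with `k` inner nodes and root `X` yields `n`
hyperedges with labels outside `N`. -/
inductive Count (R : Set (HyperRule ty)) (N : Set Lab) : Lab → ℕ → ℕ → Prop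
  | leaf (a : Lab) (ha : a ∉ N) : Count R N a 1 0
  | node (r : HyperRule ty) (hr : r ∈ R) (n k : r.rhs.E → ℕ)
      (h : ∀ e, Count R N (r.rhs.lab e) (n e) (k e)) :
      Count R N r.lhs (∑ᶠ e, n e) (1 + ∑ᶠ e, k e)

/-- The number `n` of hyperedges can be generated from `X`. -/
def Counts (R : Set (HyperRule ty)) (N : Set Lab) (X : Lab) (n : ℕ) : Prop :=
  ∃ k, Count R N X n k

/-- A derivation context from `X` to `Y` with yield `d`, seen through its effect on the numbers
that can be generated. -/
def CountContext (R : Set (HyperRule ty)) (N : Set Lab) (X Y : Lab) (d : ℕ) : Prop :=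
  ∀ n, Counts R N Y n → Counts R N X (n + d)

variable {R : Set (HyperRule ty)} {N : Set Lab}

theorem CountContext.trans {X Y Z : Lab} {d d' : ℕ} (h : CountContext R N X Y d)
    (h' : CountContext R N Y Z d') : CountContext R N X Z (d' + d) := fun n hn => by
  rw [← add_assoc]
  exact h _ (h' n hn)

theorem Count.replace_child {r : HyperRule ty} (hr : r ∈ R) {n k : r.rhs.E → ℕ}
    (h : ∀ e, Count R N (r.rhs.lab e) (n e) (k e)) (e : r.rhs.E) {m j : ℕ}
    (he : Count R N (r.rhs.lab e) m j) :
    Count R N r.lhs (m + ∑ᶠ x : {x // x ∉ ({e} : Set r.rhs.E)}, n x)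
      (1 + (j + ∑ᶠ x : {x // x ∉ ({e} : Set r.rhs.E)}, k x)) := by
  classical
  rw [← finsum_nat_update n e m, ← finsum_nat_update k e j]
  refine Count.node r hr _ _ fun x => ?_
  by_cases hx : x = e
  · subst hx
    simpa using he
  · simpa [hx] using h x

theorem countContext_child {r : HyperRule ty} (hr : r ∈ R) {n k : r.rhs.E → ℕ}
    (h : ∀ e, Count R N (r.rhs.lab e) (n e) (k e)) (e : r.rhs.E) :
    CountContext R N r.lhs (r.rhs.lab e) (∑ᶠ x : {x // x ∉ ({e} : Set r.rhs.E)}, n x) :=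
  fun _ ⟨_, hm⟩ => ⟨_, Count.replace_child hr h e hm⟩

/-- If no label below `S` pumps itself by a positive amount, then `S` generates boundedly many
hyperedges: in a smallest derivation tree no label repeats on a path, because the part between
two occurrences could be cut out. -/
theorem counts_bounded_of_no_pump [Finite Lab] (hfin : R.Finite) {S : Lab}
    (hS : ∀ X c p d, CountContext R N S X c → Counts R N X p → CountContext R N X X d → d = 0) :
    ∃ b, ∀ n, Counts R N S n → n ≤ b := by
  classical
  let _ := Fintype.ofFinite Lab
  obtain ⟨M, hM⟩ : ∃ M, ∀ r ∈ R, Nat.card r.rhs.E ≤ M := by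
    obtain ⟨M, hM⟩ := (hfin.image fun r => Nat.card r.rhs.E).bddAbove
    exact ⟨M, fun r hr => hM ⟨r, hr, rfl⟩⟩
  have key : ∀ j, ∃ b, ∀ (F : Finset Lab) (X : Lab) (n k c : ℕ), Fintype.card Lab ≤ F.card + j →
      CountContext R N S X c → Count R N X n k → (∀ k', Count R N X n k' → k ≤ k') →
      (∀ Y ∈ F, ∃ m k', CountContext R N Y X m ∧ k < k' ∧ Count R N Y (n + m) k' ∧
        ∀ k'', Count R N Y (n + m) k'' → k' ≤ k'') → n ≤ b := by
    have notMem : ∀ (F : Finset Lab) (X : Lab) (n k c : ℕ),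
        CountContext R N S X c → Count R N X n k →
        (∀ Y ∈ F, ∃ m k', CountContext R N Y X m ∧ k < k' ∧ Count R N Y (n + m) k' ∧
          ∀ k'', Count R N Y (n + m) k'' → k' ≤ k'') → X ∉ F := by
      intro F X n k c hc hX hF hXF
      obtain ⟨m, k', hm, hk, -, hmin⟩ := hF X hXF
      obtain rfl := hS X c n m hc ⟨k, hX⟩ hm
      exact absurd (hmin k hX) (not_le.2 hk)
    intro j
    induction j with
    | zero =>
      refine ⟨0, fun F X n k c hcard hc hX _ hF => ?_⟩
      have : F = Finset.univ := Finset.eq_univ_of_card F (le_antisymm (Finset.card_le_univ F) hcard)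
      exact absurd (this ▸ Finset.mem_univ X) (notMem F X n k c hc hX hF)
    | succ j ih =>
      obtain ⟨b, hb⟩ := ih
      refine ⟨max 1 (M * b), fun F X n k c hcard hc hX hmin hF => ?_⟩
      have hXF := notMem F X n k c hc hX hF
      cases hX with
      | leaf a ha => exact le_max_left _ _
      | node r hr n k h =>
        refine le_max_of_le_right ((finsum_nat_le_mul fun e => ?_).trans
          (Nat.mul_le_mul_right b (hM r hr)))
        have hn := finsum_nat_eq_add_compl n e
        have hk := finsum_nat_eq_add_compl k e
        refine hb (insert r.lhs F) (r.rhs.lab e) (n e) (k e) _ ?_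
          (hc.trans (countContext_child hr h e)) (h e) ?_ ?_
        · rw [Finset.card_insert_of_notMem hXF]
          omega
        · intro k' hk'
          have := hmin _ (hn ▸ Count.replace_child hr h e hk')
          omega
        · intro Y hY
          rcases Finset.mem_insert.1 hY with rfl | hY
          · exact ⟨_, _, countContext_child hr h e, by omega, hn ▸ Count.node r hr n k h,
              fun k'' hk'' => hmin k'' (hn ▸ hk'')⟩
          · obtain ⟨m, k', hm, hlt, hY', hmin'⟩ := hF Y hY
            have hadd : n e + (∑ᶠ x : {x // x ∉ ({e} : Set r.rhs.E)}, n x + m) =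
                ∑ᶠ x, n x + m := by omega
            refine ⟨_, k', hm.trans (countContext_child hr h e), by omega, ?_, ?_⟩
            · rw [hadd]
              exact hY'
            · rw [hadd]
              exact hmin'
  obtain ⟨b, hb⟩ := key (Fintype.card Lab)
  refine ⟨b, fun n hn => ?_⟩
  have h := Nat.find_spec hn
  exact hb ∅ S n _ 0 (by simp) (fun n hn => hn) h (fun k' hk' => Nat.find_min' hn hk') (by simp)

/-- Either `S` generates boundedly many hyperedges, or the possible numbers contain an
arithmetic progression of length three. -/
theorem counts_bounded_or_exists_progression [Finite Lab] (hfin : R.Finite) (S : Lab) :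
    (∃ b, ∀ n, Counts R N S n → n ≤ b) ∨
      ∃ p d, 0 < d ∧ Counts R N S p ∧ Counts R N S (p + d) ∧ Counts R N S (p + d + d) := by
  by_contra! h
  obtain ⟨h₁, h₂⟩ := h
  obtain ⟨b, hb⟩ := counts_bounded_of_no_pump (N := N) (S := S) hfin fun X c p d hc hp hd => by
    by_contra hd0
    have e : ∀ i, p + i + c = p + c + i := fun i => by omega
    have e' : p + d + d + c = p + c + d + d := by omega
    exact h₂ (p + c) d (Nat.pos_of_ne_zero hd0) (hc p hp) (e d ▸ hc _ (hd p hp))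
      (e' ▸ hc _ (hd _ (hd p hp)))
  obtain ⟨n, hn, hlt⟩ := h₁ b
  exact absurd (hb n hn) (not_le.2 hlt)

open HGraph

theorem finsum_replace_singleton {H K : HGraph ty} {e : H.E}
    (n : (H.replace {e} fun _ => K).E → ℕ) :
    ∑ᶠ x, n x = ∑ᶠ x : {x // x ∉ ({e} : Set H.E)}, n (Sum.inl x) +
      ∑ᶠ x, n (Sum.inr ⟨⟨e, rfl⟩, x⟩) := by
  rw [finsum_nat_sum]
  congr 1
  rw [finsum_nat_sigma]
  exact finsum_unique _

theorem Derives.exists_counts {H H' : HGraph ty} (h : Derives R H H')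
    (hH' : ∀ e, H'.lab e ∉ N) :
    ∃ n : H.E → ℕ, (∀ e, Counts R N (H.lab e) (n e)) ∧ ∑ᶠ e, n e = Nat.card H'.E := by
  have iso : ∀ {G G' : HGraph ty} {m : ℕ}, G.Iso G' →
      (∃ n : G'.E → ℕ, (∀ e, Counts R N (G'.lab e) (n e)) ∧ ∑ᶠ e, n e = m) →
      ∃ n : G.E → ℕ, (∀ e, Counts R N (G.lab e) (n e)) ∧ ∑ᶠ e, n e = m := by
    rintro G G' m ⟨gV, gE, -, hl, -⟩ ⟨n, hn, hsum⟩
    refine ⟨n ∘ gE, fun e => hl e ▸ hn (gE e), ?_⟩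
    rw [← hsum]
    exact finsum_comp_equiv gE (f := n)
  have base : ∃ n : H'.E → ℕ, (∀ e, Counts R N (H'.lab e) (n e)) ∧ ∑ᶠ e, n e = Nat.card H'.E :=
    ⟨fun _ => 1, fun e => ⟨0, Count.leaf _ (hH' e)⟩, finsum_nat_one⟩
  have step : ∀ {G G' : HGraph ty} {m : ℕ}, DirectlyDerives R G G' →
      (∃ n : G'.E → ℕ, (∀ e, Counts R N (G'.lab e) (n e)) ∧ ∑ᶠ e, n e = m) →
      ∃ n : G.E → ℕ, (∀ e, Counts R N (G.lab e) (n e)) ∧ ∑ᶠ e, n e = m := by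
    classical
    rintro G G' m ⟨e, r, hr, hlab, i⟩ hG'
    obtain ⟨n, hn, hsum⟩ := iso i.symm hG'
    rw [finsum_replace_singleton] at hsum
    refine ⟨fun f => if hf : f ∉ ({e} : Set G.E) then n (Sum.inl ⟨f, hf⟩)
      else ∑ᶠ x, n (Sum.inr ⟨⟨e, rfl⟩, x⟩), fun f => ?_, ?_⟩
    · by_cases hf : f = e
      · subst hf
        choose k hk using fun x => hn (Sum.inr ⟨⟨f, rfl⟩, x⟩)
        simp only [Set.mem_singleton_iff, not_true_eq_false, dif_neg, not_false_iff, ← hlab]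
        exact ⟨_, Count.node r hr _ k hk⟩
      · have hf' : f ∉ ({e} : Set G.E) := hf
        simp only [dif_pos hf']
        exact hn (Sum.inl ⟨f, hf'⟩)
    · rw [← hsum, finsum_nat_eq_add_compl _ e, add_comm]
      congr 1
      · exact finsum_congr fun x => dif_pos x.2
      · simp
  rcases h with h | h
  · induction h using Relation.TransGen.head_induction_on with
    | single h => exact step h base
    | head h _ ih => exact step h ih
  · exact iso h base

theorem exists_derives_of_count {H : HGraph ty} {n k : H.E → ℕ}
    (h : ∀ e, Count R N (H.lab e) (n e) (k e)) :
    ∃ H', Derives R H H' ∧ (∀ e, H'.lab e ∉ N) ∧ Nat.card H'.E = ∑ᶠ e, n e := by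
  obtain ⟨K, hK⟩ : ∃ K, ∑ᶠ e, k e = K := ⟨_, rfl⟩
  induction K generalizing H with
  | zero =>
    have hk : ∀ e, k e = 0 := fun e => by
      have := finsum_nat_eq_add_compl k e
      omega
    have hleaf : ∀ e, H.lab e ∉ N ∧ n e = 1 := by
      intro e
      have he := h e
      rw [hk e] at he
      generalize H.lab e = X, n e = m, hz : (0 : ℕ) = z at he
      cases he with
      | leaf _ ha => exact ⟨ha, rfl⟩
      | node => omega
    refine ⟨H, Or.inr (Iso.refl H), fun e => (hleaf e).1, ?_⟩
    rw [← finsum_nat_one]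
    exact finsum_congr fun e => (hleaf e).2.symm
  | succ K ih =>
    obtain ⟨e, he⟩ : ∃ e, k e ≠ 0 := by
      by_contra! h0
      simp [h0] at hK
    have hsn := finsum_nat_eq_add_compl n e
    have hsk := finsum_nat_eq_add_compl k e
    have hc := h e
    generalize hX : H.lab e = X at hc
    generalize hm : n e = m at hc hsn
    generalize hj : k e = j at hc hsk
    cases hc with
    | leaf => exact (he hj).elim
    | node r hr nr kr hcr =>
      let n' : (H.replace {e} fun _ => r.rhs).E → ℕ := Sum.elim (fun x => n x) fun p => nr p.2
      let k' : (H.replace {e} fun _ => r.rhs).E → ℕ := Sum.elim (fun x => k x) fun p => kr p.2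
      have hn' : ∑ᶠ x, n' x = ∑ᶠ x, n x := by
        rw [finsum_replace_singleton, hsn, add_comm]
        rfl
      have hk' : ∑ᶠ x, k' x = K := by
        have : ∑ᶠ x, k' x = ∑ᶠ x : {x // x ∉ ({e} : Set H.E)}, k x + ∑ᶠ x, kr x :=
          finsum_replace_singleton _
        omega
      obtain ⟨H', hH', hterm, hcard⟩ := ih (H := H.replace {e} fun _ => r.rhs) (n := n') (k := k')
        (by
          rintro (x | ⟨_, x⟩)
          · exact h x
          · exact hcr x) hk'
      exact ⟨H', Derives.head ⟨e, r, hr, hX.symm, Iso.refl _⟩ hH', hterm, hcard.trans hn'⟩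

end Counting

theorem HGraph.Represents.card_eq {Lab : Type} {ty : Lab → ℕ} {H : HGraph ty} {w : List Lab}
    (h : H.Represents w) : Nat.card H.E = w.length := by
  obtain ⟨_, _, gE, -⟩ := h
  rw [Nat.card_congr gE, Nat.card_fin]

/-- The lengths of the words of a hyperedge replacement string language are bounded or contain
an arithmetic progression of length three. -/
theorem HRGrammar.lengths_bounded_or_exists_progression {A : Type*} (G : HRGrammar)
    (ι : A ↪ G.Lab) {L : Language A} (h : GeneratesString G.language ι L) :
    (∃ b, ∀ w ∈ L, w.length ≤ b) ∨
      ∃ p d, 0 < d ∧ (∃ w ∈ L, w.length = p) ∧ (∃ w ∈ L, w.length = p + d) ∧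
        ∃ w ∈ L, w.length = p + d + d := by
  have := G.finite_Lab
  obtain ⟨hstr, hL⟩ := h
  have exists_word : ∀ n, Counts G.rules G.nonterminals G.start n → ∃ w ∈ L, w.length = n := by
    rintro n ⟨k, hk⟩
    obtain ⟨H, hH, hterm, hcard⟩ := exists_derives_of_count (R := G.rules) (N := G.nonterminals)
      (H := HGraph.handle G.ty G.start) (n := fun _ => n) (k := fun _ => k) (fun _ => hk)
    obtain ⟨v, hv⟩ := hstr H ⟨hH, hterm⟩
    have hv' : v ∈ STR G.language := ⟨H, ⟨hH, hterm⟩, hv⟩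
    rw [hL] at hv'
    obtain ⟨w, ⟨hw, -⟩, rfl⟩ := hv'
    refine ⟨w, hw, ?_⟩
    rw [← List.length_map (as := w) ι, ← hv.card_eq, hcard]
    exact finsum_unique _
  rcases counts_bounded_or_exists_progression (N := G.nonterminals) G.finite_rules G.start with
    ⟨b, hb⟩ | ⟨p, d, hd, h₁, h₂, h₃⟩
  · refine Or.inl ⟨b, fun w hw => ?_⟩
    by_cases hw0 : w = []
    · simp [hw0]
    have hw' : w.map ι ∈ STR G.language := hL ▸ ⟨w, ⟨hw, hw0⟩, rfl⟩
    obtain ⟨H, hH, hrep⟩ := hw'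
    obtain ⟨n, hn, hsum⟩ := hH.1.exists_counts hH.2
    have hcard := hrep.card_eq
    rw [← hsum, List.length_map] at hcard
    rw [← hcard]
    exact (finsum_unique n).trans_le (hb _ (hn default))
  · exact Or.inr ⟨p, d, hd, exists_word _ h₁, exists_word _ h₂, exists_word _ h₃⟩


/-! ### Threaded hypergraphs -/

namespace HGraph

variable {Lab : Type} {ty ty' : Lab → ℕ}

/-- `Trail H u l v`: the list `l` of arcs leads from the node `u` to the node `v`. An arc `(e, c)`
runs from attachment node `2c` to attachment node `2c + 1` of the hyperedge `e`. -/
inductive Trail (H : HGraph ty) : H.V → List (H.E × ℕ) → H.V → Prop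
  | nil (v : H.V) : Trail H v [] v
  | cons {u v w : H.V} {e : H.E} {c : ℕ} {l : List (H.E × ℕ)} (hu : (H.att e)[2 * c]? = some u)
      (hv : (H.att e)[2 * c + 1]? = some v) (h : Trail H v l w) : Trail H u ((e, c) :: l) w

theorem Trail.append {H : HGraph ty} {u v w : H.V} {l l' : List (H.E × ℕ)} (h : H.Trail u l v)
    (h' : H.Trail v l' w) : H.Trail u (l ++ l') w := by
  induction h with
  | nil => exact h'
  | cons hu hv _ ih => exact Trail.cons hu hv (ih h')

theorem Trail.map {H : HGraph ty} {K : HGraph ty'} {fV : H.V → K.V} {fE : H.E → K.E}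
    (hf : ∀ e, K.att (fE e) = (H.att e).map fV) {u v : H.V} {l : List (H.E × ℕ)}
    (h : H.Trail u l v) : K.Trail (fV u) (l.map (Prod.map fE id)) (fV v) := by
  induction h with
  | nil => exact Trail.nil _
  | cons hu hv _ ih => exact Trail.cons (by simp [hf, hu]) (by simp [hf, hv]) ih

theorem Trail.exists_nodes {H : HGraph ty} {u v : H.V} {l : List (H.E × ℕ)} (h : H.Trail u l v) :
    ∃ f : ℕ → H.V, f 0 = u ∧ f l.length = v ∧ ∀ (i : ℕ) (e : H.E) (c : ℕ), l[i]? = some (e, c) →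
      (H.att e)[2 * c]? = some (f i) ∧ (H.att e)[2 * c + 1]? = some (f (i + 1)) := by
  induction h with
  | nil v => exact ⟨fun _ => v, rfl, rfl, by simp⟩
  | @cons u v w e c l hu hv _ ih =>
    obtain ⟨f, h0, hl, hf⟩ := ih
    refine ⟨fun i => Nat.casesOn i u f, rfl, hl, ?_⟩
    rintro (_ | i) e' c' h
    · obtain ⟨rfl, rfl⟩ : e = e' ∧ c = c' := by simpa using h
      exact ⟨hu, by simpa [h0] using hv⟩
    · exact hf i e' c' (by simpa using h)

/-- `H` is a disjoint union of paths, the `j`-th of which leads from external node `2j` to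
external node `2j + 1` along the arcs `W[j]`; every hyperedge contributes all its arcs, each
exactly once. Since the paths cover all nodes, the last condition says that no node is
visited twice. -/
structure Threaded (H : HGraph ty) (W : List (List (H.E × ℕ))) : Prop where
  ext_length : H.ext.length = 2 * W.length
  trail : ∀ j l, W[j]? = some l →
    ∃ u v, H.ext[2 * j]? = some u ∧ H.ext[2 * j + 1]? = some v ∧ H.Trail u l v
  nodup : W.flatten.Nodup
  mem_iff : ∀ e c, (e, c) ∈ W.flatten ↔ 2 * c + 1 < ty (H.lab e)
  cover : ∀ v, ∃ e, v ∈ H.att e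
  card : ∑ᶠ e, ty (H.lab e) + H.ext.length ≤ 2 * Nat.card H.V

theorem Threaded.of_iso {H K : HGraph ty} {W : List (List (H.E × ℕ))} (h : H.Threaded W)
    {gV : H.V ≃ K.V} {gE : H.E ≃ K.E} (ha : ∀ e, K.att (gE e) = (H.att e).map gV)
    (hl : ∀ e, K.lab (gE e) = H.lab e) (hx : H.ext.map gV = K.ext) :
    K.Threaded (W.map (List.map (Prod.map gE id))) := by
  have hflat : (W.map (List.map (Prod.map gE id))).flatten = W.flatten.map (Prod.map gE id) :=
    List.map_flatten.symm
  have hinj : Function.Injective (Prod.map gE id : H.E × ℕ → K.E × ℕ) :=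
    gE.injective.prodMap Function.injective_id
  constructor
  · simp [← hx, h.ext_length]
  · intro j l hj
    rw [List.getElem?_map, Option.map_eq_some_iff] at hj
    obtain ⟨l, hj, rfl⟩ := hj
    obtain ⟨u, v, hu, hv, ht⟩ := h.trail j l hj
    exact ⟨gV u, gV v, by simp [← hx, hu], by simp [← hx, hv], ht.map ha⟩
  · rw [hflat]
    exact h.nodup.map hinj
  · intro e c
    obtain ⟨e, rfl⟩ := gE.surjective e
    rw [hflat, hl, ← h.mem_iff]
    exact List.mem_map_of_injective hinj (a := (e, c))
  · intro v
    obtain ⟨e, he⟩ := h.cover (gV.symm v)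
    exact ⟨gE e, by rw [ha]; exact List.mem_map.2 ⟨_, he, by simp⟩⟩
  · rw [← Nat.card_congr gV, ← hx, List.length_map, ← finsum_comp_equiv gE]
    simpa [hl] using h.card

theorem threaded_handle {X : Lab} (hX : Even (ty X)) :
    (handle ty X).Threaded ((List.range (ty X / 2)).map fun c => [((), c)]) := by
  have hX' : 2 * (ty X / 2) = ty X := Nat.two_mul_div_two_of_even hX
  have hflat : ((List.range (ty X / 2)).map fun c => [((), c)]).flatten =
      (List.range (ty X / 2)).map fun c => ((), c) := by
    rw [← List.flatMap_def, List.map_eq_flatMap]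
  constructor
  · simp [hX']
  · intro j l hj
    simp only [List.getElem?_map, Option.map_eq_some_iff] at hj
    obtain ⟨c, hc, rfl⟩ := hj
    obtain ⟨hj, hc⟩ := List.getElem?_eq_some_iff.1 hc
    simp only [List.length_range] at hj
    rw [List.getElem_range] at hc
    subst hc
    have h1 : (List.finRange (ty X))[2 * j]? = some ⟨2 * j, by omega⟩ :=
      List.getElem?_eq_some_iff.2 ⟨by simp; omega, by simp⟩
    have h2 : (List.finRange (ty X))[2 * j + 1]? = some ⟨2 * j + 1, by omega⟩ :=
      List.getElem?_eq_some_iff.2 ⟨by simp; omega, by simp⟩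
    exact ⟨_, _, h1, h2, Trail.cons h1 h2 (Trail.nil _)⟩
  · rw [hflat]
    exact List.nodup_range.map fun a b h => (Prod.mk.inj h).2
  · intro e c
    rw [hflat]
    simp
    omega
  · exact fun v => ⟨(), List.mem_finRange v⟩
  · rw [Nat.card_fin, finsum_unique]
    simp
    omega

section Replace

variable {H : HGraph ty} {σ : H.E → HGraph ty}

/-- The hyperedge `x` of `σ e`, as a hyperedge of the hypergraph in which every hyperedge `e` was
replaced by `σ e`. -/
abbrev liftEdge (σ : H.E → HGraph ty) (e : H.E) (x : (σ e).E) :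
    (H.replace Set.univ fun e => σ e).E :=
  Sum.inr ⟨⟨e, trivial⟩, x⟩

/-- The arcs that take the place of an arc `(e, c)` when `e` is replaced by `σ e`. -/
def substArc (σ : H.E → HGraph ty) (Wσ : ∀ e, List (List ((σ e).E × ℕ))) (x : H.E × ℕ) :
    List ((H.replace Set.univ fun e => σ e).E × ℕ) :=
  ((Wσ x.1).getD x.2 []).map (Prod.map (liftEdge σ x.1) id)

theorem finsum_replace_univ (n : (H.replace Set.univ fun e => σ e).E → ℕ) :
    ∑ᶠ x, n x = ∑ᶠ e, ∑ᶠ x, n (liftEdge σ e x) := by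
  rw [finsum_nat_sum]
  have : IsEmpty {e : H.E // e ∉ (Set.univ : Set H.E)} := ⟨fun e => e.2 trivial⟩
  rw [finsum_of_isEmpty, zero_add, finsum_nat_sigma]
  exact finsum_comp_equiv (Equiv.Set.univ H.E)
    (f := fun e => ∑ᶠ x, n (liftEdge σ e x))

/-- Gluing along repetition-free external sequences loses at most one node per attachment. -/
theorem card_replace_univ_le (hlen : ∀ e, (σ e).ext.length = ty (H.lab e))
    (hnd : ∀ e, (σ e).ext.Nodup) :
    Nat.card H.V + ∑ᶠ e, Nat.card (σ e).V ≤
      Nat.card (H.replace Set.univ fun e => σ e).V + ∑ᶠ e, ty (H.lab e) := by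
  classical
  let Y := H.V ⊕ Σ e, {u : (σ e).V // u ∉ (σ e).ext}
  let F : (H.replace Set.univ fun e => σ e).V → Y := Quot.lift
    (Sum.elim Sum.inl fun p => if h : p.2 ∈ (σ p.1).ext then
      Sum.inl ((H.att p.1)[(σ p.1).ext.idxOf p.2]'(by
        rw [H.att_length, ← hlen]; exact List.idxOf_lt_length_iff.2 h))
      else Sum.inr ⟨p.1, p.2, h⟩) (by
    rintro _ _ ⟨e, i, v, u, hv, hu⟩
    obtain ⟨hi, rfl⟩ := List.getElem?_eq_some_iff.1 hu
    obtain ⟨hi', rfl⟩ := List.getElem?_eq_some_iff.1 hv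
    simp [(hnd e).idxOf_getElem])
  have hF : F.Surjective := by
    rintro (v | ⟨e, u, hu⟩)
    · exact ⟨Quot.mk _ (Sum.inl v), rfl⟩
    · exact ⟨Quot.mk _ (Sum.inr ⟨⟨e, trivial⟩, u⟩), by simp [F, hu]⟩
  have hY : Nat.card Y ≤ Nat.card (H.replace Set.univ fun e => σ e).V :=
    Nat.card_le_card_of_surjective F hF
  have hsplit : ∀ e, Nat.card (σ e).V =
      ty (H.lab e) + Nat.card {u : (σ e).V // u ∉ (σ e).ext} := by
    intro e
    rw [← Nat.card_congr (Equiv.sumCompl fun u => u ∈ (σ e).ext), Nat.card_sum, ← hlen,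
      ← Nat.card_congr ((hnd e).getEquiv), Nat.card_fin]
  let _ := Fintype.ofFinite H.E
  have hY' : Nat.card Y = Nat.card H.V +
      ∑ e, Nat.card {u : (σ e).V // u ∉ (σ e).ext} := by
    rw [Nat.card_sum, Nat.card_sigma]
  rw [finsum_eq_sum_of_fintype, finsum_eq_sum_of_fintype]
  have hsum : ∑ e, Nat.card (σ e).V =
      ∑ e, ty (H.lab e) + ∑ e, Nat.card {u : (σ e).V // u ∉ (σ e).ext} := by
    rw [← Finset.sum_add_distrib]
    exact Finset.sum_congr rfl fun e _ => hsplit e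
  rw [hsum]
  omega

theorem Trail.flatMap_substArc {Wσ : ∀ e, List (List ((σ e).E × ℕ))}
    (hσ : ∀ e, (σ e).Threaded (Wσ e)) (hlen : ∀ e, (σ e).ext.length = ty (H.lab e))
    {u v : H.V} {l : List (H.E × ℕ)} (h : H.Trail u l v) :
    (H.replace Set.univ fun e => σ e).Trail (Quot.mk _ (Sum.inl u))
      (l.flatMap (substArc σ Wσ)) (Quot.mk _ (Sum.inl v)) := by
  induction h with
  | nil => exact Trail.nil _
  | @cons u v w e c l hu hv _ ih =>
    have hc : 2 * c + 1 < ty (H.lab e) := by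
      rw [← H.att_length e]
      exact (List.getElem?_eq_some_iff.1 hv).1
    have hc' : c < (Wσ e).length := by
      have := (hσ e).ext_length
      rw [hlen] at this
      omega
    obtain ⟨u', v', hu', hv', ht⟩ := (hσ e).trail c _ (List.getElem?_eq_getElem hc')
    rw [List.flatMap_cons]
    refine Trail.append ?_ ih
    rw [glue_sound (B := Set.univ) (σ := fun e => σ e) (e := ⟨e, trivial⟩) hu hu',
      glue_sound (B := Set.univ) (σ := fun e => σ e) (e := ⟨e, trivial⟩) hv hv']
    have : substArc σ Wσ (e, c) = ((Wσ e)[c]).map (Prod.map (liftEdge σ e) id) := by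
      rw [substArc, List.getD_eq_getElem _ _ hc']
    rw [this]
    exact ht.map (K := H.replace Set.univ fun e => σ e)
      (fV := fun u => Quot.mk _ (Sum.inr ⟨⟨e, trivial⟩, u⟩)) fun x => rfl

/-- Threaded hypergraphs are closed under parallel replacement by repetition-free threaded
hypergraphs. -/
theorem Threaded.replace {W : List (List (H.E × ℕ))} (hW : H.Threaded W)
    {Wσ : ∀ e, List (List ((σ e).E × ℕ))} (hσ : ∀ e, (σ e).Threaded (Wσ e))
    (hlen : ∀ e, (σ e).ext.length = ty (H.lab e)) (hnd : ∀ e, (σ e).ext.Nodup) :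
    (H.replace Set.univ fun e => σ e).Threaded (W.map (List.flatMap (substArc σ Wσ))) := by
  have hflat : (W.map (List.flatMap (substArc σ Wσ))).flatten =
      W.flatten.flatMap (substArc σ Wσ) := by
    clear hW
    induction W with
    | nil => rfl
    | cons l W ih => rw [List.map_cons, List.flatten_cons, List.flatten_cons,
        List.flatMap_append, ih]
  have hWlen : ∀ e, 2 * (Wσ e).length = ty (H.lab e) := fun e => by
    rw [← hlen, (hσ e).ext_length]
  constructor
  · simp [hW.ext_length]
  · intro j l hj
    rw [List.getElem?_map, Option.map_eq_some_iff] at hj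
    obtain ⟨l, hj, rfl⟩ := hj
    obtain ⟨u, v, hu, hv, ht⟩ := hW.trail j l hj
    exact ⟨_, _, by simp [hu], by simp [hv], ht.flatMap_substArc hσ hlen⟩
  · rw [hflat, List.nodup_flatMap]
    have hinj : ∀ e, Function.Injective
        (Prod.map (liftEdge σ e) id : (σ e).E × ℕ → _ × ℕ) := by
      intro e
      refine Function.Injective.prodMap (fun x y h => ?_) Function.injective_id
      simp only [liftEdge, Sum.inr.injEq] at h
      cases h
      rfl
    have hfl := fun e => List.nodup_flatten.1 (hσ e).nodup
    constructor
    · rintro ⟨e, c⟩ -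
      refine List.Nodup.map (hinj e) ?_
      by_cases hc : c < (Wσ e).length
      · simp only [List.getD_eq_getElem _ _ hc]
        exact (hfl e).1 _ (List.getElem_mem hc)
      · rw [List.getD_eq_default _ _ (not_lt.1 hc)]
        exact List.nodup_nil
    · refine hW.nodup.imp ?_
      rintro ⟨e, c⟩ ⟨e', c'⟩ hne y hy hy'
      obtain ⟨z, hz, rfl⟩ := List.mem_map.1 hy
      obtain ⟨z', hz', heq⟩ := List.mem_map.1 hy'
      have hlt : ∀ {e c z}, z ∈ (Wσ e).getD c [] → c < (Wσ e).length := by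
        intro e c z hz
        by_contra hc
        rw [List.getD_eq_default _ _ (not_lt.1 hc)] at hz
        exact List.not_mem_nil hz
      by_cases he : e' = e
      · subst he
        rw [hinj e' heq] at hz'
        have hc : c ≠ c' := fun h => hne (by rw [h])
        have hpw := List.pairwise_iff_getElem.1 (hfl e').2
        have h1 := hlt hz
        have h2 := hlt hz'
        simp only [List.getD_eq_getElem _ _ h1] at hz
        simp only [List.getD_eq_getElem _ _ h2] at hz'
        rcases lt_or_gt_of_ne hc with hc | hc
        · exact hpw _ _ h1 h2 hc hz hz'
        · exact hpw _ _ h2 h1 hc hz' hz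
      · have h := (Prod.mk.inj heq).1
        simp only [liftEdge, Sum.inr.injEq] at h
        exact he (congrArg (fun p => p.1.1) h)
  · rintro (⟨e, he⟩ | ⟨⟨e, -⟩, x⟩) d
    · exact (he trivial).elim
    · rw [hflat]
      change _ ↔ 2 * d + 1 < ty ((σ e).lab x)
      rw [← (hσ e).mem_iff, List.mem_flatMap]
      constructor
      · rintro ⟨⟨e', c⟩, -, hy⟩
        obtain ⟨z, hz, heq⟩ := List.mem_map.1 hy
        have h := (Prod.mk.inj heq).1
        have hd := (Prod.mk.inj heq).2
        simp only [liftEdge, Sum.inr.injEq] at h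
        obtain ⟨z, d'⟩ := z
        cases h
        simp only [id] at hd
        subst hd
        simp only at hz
        by_cases hc : c < (Wσ e).length
        · rw [List.getD_eq_getElem _ _ hc] at hz
          exact List.mem_flatten.2 ⟨_, List.getElem_mem hc, hz⟩
        · rw [List.getD_eq_default _ _ (not_lt.1 hc)] at hz
          exact (List.not_mem_nil hz).elim
      · intro h
        obtain ⟨l, hl, hx⟩ := List.mem_flatten.1 h
        obtain ⟨c, hc, rfl⟩ := List.getElem_of_mem hl
        refine ⟨(e, c), (hW.mem_iff e c).2 ?_, List.mem_map.2 ⟨(x, d), ?_, rfl⟩⟩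
        · have := hWlen e
          omega
        · simpa only [List.getD_eq_getElem _ _ hc] using hx
  · have hinr : ∀ (e : H.E) (u : (σ e).V), ∃ f, (Quot.mk _ (Sum.inr ⟨⟨e, trivial⟩, u⟩) :
        (H.replace Set.univ fun e => σ e).V) ∈ (H.replace Set.univ fun e => σ e).att f := by
      intro e u
      obtain ⟨x, hx⟩ := (hσ e).cover u
      exact ⟨liftEdge σ e x, List.mem_map.2 ⟨u, hx, rfl⟩⟩
    rintro ⟨v | ⟨⟨e, -⟩, u⟩⟩
    · obtain ⟨e, he⟩ := hW.cover v
      obtain ⟨i, hi, rfl⟩ := List.getElem_of_mem he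
      have hi' : i < (σ e).ext.length := by rwa [hlen, ← H.att_length]
      have := glue_sound (B := Set.univ) (σ := fun e => σ e) (e := ⟨e, trivial⟩)
        (List.getElem?_eq_getElem hi) (List.getElem?_eq_getElem hi')
      rw [this]
      exact hinr e _
    · exact hinr e u
  · have h1 := card_replace_univ_le hlen hnd
    have h2 := hW.card
    have h3 := fun e => (hσ e).card
    rw [finsum_replace_univ]
    simp only [hlen] at h3
    change ∑ᶠ e, ∑ᶠ x, ty ((σ e).lab x) + (H.ext.map _).length ≤ _
    rw [List.length_map]
    let _ := Fintype.ofFinite H.E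
    simp only [finsum_eq_sum_of_fintype (α := H.E)] at *
    have h4 := Finset.sum_le_sum fun e (_ : e ∈ Finset.univ) => h3 e
    rw [Finset.sum_add_distrib, ← Finset.mul_sum] at h4
    omega

end Replace

/-- A threaded hypergraph consisting of a single path of hyperedges of type two is a string
graph. -/
theorem Threaded.represents {H : HGraph ty} {l : List (H.E × ℕ)} (h : H.Threaded [l])
    (h2 : ∀ e, ty (H.lab e) = 2) : H.Represents (l.map fun x => H.lab x.1) := by
  classical
  obtain ⟨u, v, hu, hv, ht⟩ := h.trail 0 l rfl
  obtain ⟨f, hf0, hfl, hf⟩ := ht.exists_nodes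
  have hnd : l.Nodup := by simpa using h.nodup
  have hmem : ∀ e c, (e, c) ∈ l ↔ c = 0 := fun e c => by
    have := h.mem_iff e c
    rw [h2] at this
    simp only [List.flatten_cons, List.flatten_nil, List.append_nil] at this
    rw [this]
    omega
  have hsnd : ∀ i (hi : i < l.length), l[i] = (l[i].1, 0) := fun i hi =>
    Prod.ext rfl ((hmem l[i].1 l[i].2).1 (List.getElem_mem hi))
  have hatt : ∀ i (hi : i < l.length), H.att l[i].1 = [f i, f (i + 1)] := by
    intro i hi
    obtain ⟨h0, h1⟩ := hf i l[i].1 0 (by rw [← hsnd i hi]; exact List.getElem?_eq_getElem hi)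
    have hlen := (H.att_length l[i].1).trans (h2 _)
    match hl : H.att l[i].1, hlen with
    | [a, b], _ =>
      rw [hl] at h0 h1
      simp at h0 h1
      rw [h0, h1]
  let gE : Fin l.length → H.E := fun i => l[i].1
  have hgE : gE.Bijective := by
    constructor
    · intro i j hij
      have : l[i.1] = l[j.1] := by
        rw [hsnd i i.2, hsnd j j.2]
        exact Prod.ext hij rfl
      exact Fin.ext ((hnd.getElem_inj_iff).1 this)
    · intro e
      obtain ⟨i, hi, he⟩ := List.getElem_of_mem ((hmem e 0).2 rfl)
      exact ⟨⟨i, hi⟩, by simp [gE, he]⟩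
  have hE : Nat.card H.E = l.length := by
    rw [← Nat.card_congr (Equiv.ofBijective gE hgE), Nat.card_fin]
  let gV : Fin (l.length + 1) → H.V := fun i => f i
  have hgVs : gV.Surjective := by
    intro x
    obtain ⟨e, he⟩ := h.cover x
    obtain ⟨i, rfl⟩ := hgE.2 e
    simp only [gE, Fin.getElem_fin, hatt i i.2, List.mem_cons, List.not_mem_nil, or_false] at he
    rcases he with rfl | rfl
    · exact ⟨i.castSucc, rfl⟩
    · exact ⟨i.succ, rfl⟩
  have hgV : gV.Bijective := by
    refine hgVs.bijective_of_nat_card_le ?_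
    have := h.card
    have h3 := finsum_nat_le_mul (n := fun e => ty (H.lab e)) (b := 2) fun e => (h2 e).le
    have h4 : ∑ᶠ e, ty (H.lab e) = Nat.card H.E * 2 := by
      simp only [h2]
      let _ := Fintype.ofFinite H.E
      rw [finsum_eq_sum_of_fintype]
      simp
    rw [h.ext_length] at this
    simp at this
    rw [Nat.card_fin]
    omega
  have hw : ∀ a ∈ l.map fun x => H.lab x.1, ty a = 2 := by
    intro a ha
    obtain ⟨x, -, rfl⟩ := List.mem_map.1 ha
    exact h2 _
  refine ⟨hw, Iso.symm ?_⟩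
  refine ⟨(finCongr (by simp)).trans (Equiv.ofBijective gV hgV),
    (finCongr (by simp)).trans (Equiv.ofBijective gE hgE), ?_, ?_, ?_⟩
  · intro i
    have hi : i.1 < l.length := by simpa using i.2
    simpa [gE, gV] using hatt i hi
  · intro i
    simp [gE]
  · have hlen := h.ext_length
    match hl : H.ext, hlen with
    | [a, b], _ =>
      rw [hl] at hu hv
      simp at hu hv
      simp [gV, hf0, hfl, hu, hv]

theorem Represents.unique {H : HGraph ty} {w w' : List Lab} (h : H.Represents w)
    (h' : H.Represents w') : w = w' := by
  obtain ⟨hw, i⟩ := h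
  obtain ⟨hw', i'⟩ := h'
  obtain ⟨gV, gE, ha, hl, hx⟩ := Iso.trans (Iso.symm i) i'
  have hlen : w.length = w'.length := by simpa using Fintype.card_congr gE
  have hV : ∀ i (hi : i < w.length + 1), (gV ⟨i, hi⟩).1 = i := by
    intro i
    induction i with
    | zero =>
      intro hi
      have : gV 0 = 0 := by simpa using (List.cons.inj hx).1
      exact congrArg Fin.val this
    | succ i ih =>
      intro hi
      have hi' : i < w.length := by omega
      have := ha ⟨i, hi'⟩
      simp only [List.map_cons, List.map_nil, List.cons.injEq, and_true] at this
      have h1 := congrArg Fin.val this.1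
      have h2 := congrArg Fin.val this.2
      have h3 := ih (by omega)
      simp only [Fin.val_castSucc, Fin.val_succ, Fin.castSucc_mk, Fin.succ_mk] at h1 h2
      omega
  refine List.ext_getElem hlen fun i h1 h2 => ?_
  have := ha ⟨i, h1⟩
  simp only [List.map_cons, List.map_nil, List.cons.injEq, and_true] at this
  have h3 := congrArg Fin.val this.1
  have h4 := hV i (by omega)
  simp only [Fin.val_castSucc, Fin.castSucc_mk] at h3
  have h5 := hl ⟨i, h1⟩
  have h6 : gE ⟨i, h1⟩ = ⟨i, h2⟩ := Fin.ext (h3.trans h4)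
  rw [h6] at h5
  exact h5.symm

end HGraph


/-! ### Threaded hypergraphs from lists of arcs -/

section

variable {α : Type*}

theorem List.exists_of_mem_flatten_getElem {W : List (List α)} {x : α} (h : x ∈ W.flatten) :
    ∃ p : Σ j : Fin W.length, Fin (W[j]).length, (W[p.1])[p.2] = x := by
  obtain ⟨l, hl, hx⟩ := List.mem_flatten.1 h
  obtain ⟨j, hj, rfl⟩ := List.getElem_of_mem hl
  obtain ⟨i, hi, rfl⟩ := List.getElem_of_mem hx
  exact ⟨⟨⟨j, hj⟩, ⟨i, hi⟩⟩, rfl⟩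

theorem List.Nodup.flatten_getElem_inj {W : List (List α)} (h : W.flatten.Nodup)
    {p q : Σ j : Fin W.length, Fin (W[j]).length} (hpq : (W[p.1])[p.2] = (W[q.1])[q.2]) :
    p = q := by
  obtain ⟨h1, h2⟩ := List.nodup_flatten.1 h
  rw [List.pairwise_iff_getElem] at h2
  obtain ⟨⟨j, hj⟩, i, hi⟩ := p
  obtain ⟨⟨j', hj'⟩, i', hi'⟩ := q
  simp only [Fin.getElem_fin] at hpq hi hi'
  rcases lt_trichotomy j j' with hlt | rfl | hlt
  · exact (h2 j j' hj hj' hlt (List.getElem_mem hi) (hpq ▸ List.getElem_mem hi')).elim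
  · obtain rfl := ((h1 _ (List.getElem_mem hj)).getElem_inj_iff).1 hpq
    rfl
  · exact (h2 j' j hj' hj hlt (List.getElem_mem hi') (hpq ▸ List.getElem_mem hi)).elim

/-- A position at which `x` occurs in a list of lists. -/
noncomputable def flattenIndex {W : List (List α)} {x : α} (h : x ∈ W.flatten) :
    Σ j : Fin W.length, Fin (W[j]).length :=
  (List.exists_of_mem_flatten_getElem h).choose

theorem flattenIndex_eq {W : List (List α)} (hW : W.flatten.Nodup) {x : α} (h : x ∈ W.flatten)
    {p : Σ j : Fin W.length, Fin (W[j]).length} (hp : (W[p.1])[p.2] = x) :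
    flattenIndex h = p :=
  hW.flatten_getElem_inj ((List.exists_of_mem_flatten_getElem h).choose_spec.trans hp.symm)

end

namespace HGraph

variable {Lab : Type} {ty : Lab → ℕ} {E : Type} [Finite E]

/-- The disjoint union of paths with hyperedges from `E` in which the `j`-th path consists of the
arcs `W[j]`; the ends of the paths are the external nodes. -/
noncomputable abbrev threadGraph (ty : Lab → ℕ) (lab : E → Lab) (W : List (List (E × ℕ)))
    (hW : ∀ e c, 2 * c < ty (lab e) → (e, c) ∈ W.flatten) : HGraph ty where
  V := Σ j : Fin W.length, Fin ((W[j]).length + 1)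
  E := E
  finite_V := inferInstance
  finite_E := inferInstance
  att e := List.ofFn fun k : Fin (ty (lab e)) =>
    have h : (e, k.1 / 2) ∈ W.flatten := hW e _ (by omega)
    ⟨(flattenIndex h).1, if k.1 % 2 = 0 then (flattenIndex h).2.castSucc
      else (flattenIndex h).2.succ⟩
  lab := lab
  ext := List.ofFn fun k : Fin (2 * W.length) =>
    ⟨⟨k.1 / 2, by omega⟩, if k.1 % 2 = 0 then 0 else Fin.last _⟩
  att_length e := by simp

variable {lab : E → Lab} {W : List (List (E × ℕ))}
  {hW : ∀ e c, 2 * c < ty (lab e) → (e, c) ∈ W.flatten}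

theorem threadGraph_ext_length : (threadGraph ty lab W hW).ext.length = 2 * W.length := by
  simp [threadGraph]

theorem threadGraph_ext_nodup (hne : ∀ l ∈ W, l ≠ []) : (threadGraph ty lab W hW).ext.Nodup := by
  simp only [threadGraph, List.nodup_ofFn]
  intro k k' h
  obtain ⟨h1, h2⟩ := Sigma.mk.inj_iff.1 h
  have h1' : k.1 / 2 = k'.1 / 2 := congrArg Fin.val h1
  have hpos : W[k.1 / 2].length ≠ 0 := fun h =>
    hne _ (List.getElem_mem _) (List.length_eq_zero_iff.1 h)
  have h3 : (if k.1 % 2 = 0 then 0 else W[k.1 / 2].length) =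
      (if k'.1 % 2 = 0 then 0 else W[k.1 / 2].length) := by
    have key : ∀ {j j' : Fin W.length} {a : Fin (W[j].length + 1)} {b : Fin (W[j'].length + 1)},
        j = j' → HEq a b → a.1 = b.1 := by
      rintro j _ a b rfl h
      rw [eq_of_heq h]
    have := key h1 h2
    simp only [apply_ite Fin.val, Fin.val_zero, Fin.val_last, Fin.getElem_fin] at this
    simp only [← h1'] at this
    exact this
  apply Fin.ext
  split_ifs at h3 <;> omega

theorem threadGraph_att (hnd : W.flatten.Nodup) {j : Fin W.length} {i : Fin (W[j]).length}
    {e : E} {c : ℕ} (h : (W[j])[i] = (e, c)) (hc : 2 * c + 1 < ty (lab e)) :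
    ((threadGraph ty lab W hW).att e)[2 * c]? = some ⟨j, i.castSucc⟩ ∧
      ((threadGraph ty lab W hW).att e)[2 * c + 1]? = some ⟨j, i.succ⟩ := by
  have hmem : (e, c) ∈ W.flatten :=
    List.mem_flatten.2 ⟨_, List.getElem_mem j.2, h ▸ List.getElem_mem i.2⟩
  have hidx : flattenIndex hmem = ⟨j, i⟩ := flattenIndex_eq (p := ⟨j, i⟩) hnd hmem h
  have h1 : ∀ {c'} (h' : (e, c') ∈ W.flatten), c' = c → flattenIndex h' = ⟨j, i⟩ := by
    rintro _ h' rfl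
    exact hidx
  constructor
  · refine List.getElem?_eq_some_iff.2 ⟨by simp; omega, ?_⟩
    simp only [List.getElem_ofFn, Nat.mul_mod_right, if_true]
    exact congrArg (fun p : Σ j : Fin W.length, Fin (W[j]).length =>
      (⟨p.1, p.2.castSucc⟩ : (threadGraph ty lab W hW).V)) (h1 _ (show 2 * c / 2 = c by omega))
  · refine List.getElem?_eq_some_iff.2 ⟨by simp; omega, ?_⟩
    have : (2 * c + 1) % 2 ≠ 0 := by omega
    simp only [List.getElem_ofFn, this, if_false]
    exact congrArg (fun p : Σ j : Fin W.length, Fin (W[j]).length =>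
      (⟨p.1, p.2.succ⟩ : (threadGraph ty lab W hW).V)) (h1 _ (show (2 * c + 1) / 2 = c by omega))

theorem threaded_threadGraph (hne : ∀ l ∈ W, l ≠ []) (hnd : W.flatten.Nodup)
    (hmem : ∀ e c, (e, c) ∈ W.flatten ↔ 2 * c + 1 < ty (lab e)) (heven : ∀ e, Even (ty (lab e))) :
    (threadGraph ty lab W hW).Threaded W := by
  have hmem' : ∀ {j : Fin W.length} {i : Fin (W[j]).length},
      2 * (W[j])[i].2 + 1 < ty (lab (W[j])[i].1) := fun {j i} =>
    (hmem _ _).1 (List.mem_flatten.2 ⟨_, List.getElem_mem j.2, List.getElem_mem i.2⟩)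
  constructor
  · exact threadGraph_ext_length
  · intro j l hj
    obtain ⟨hlt, rfl⟩ := List.getElem?_eq_some_iff.1 hj
    clear hj
    have hstart : ∀ {j'} (h : j' < W.length), j' = j →
        (⟨⟨j', h⟩, 0⟩ : (threadGraph ty lab W hW).V) = ⟨⟨j, hlt⟩, 0⟩ := by
      rintro _ h rfl
      rfl
    have hend : ∀ {j'} (h : j' < W.length), j' = j →
        (⟨⟨j', h⟩, Fin.last _⟩ : (threadGraph ty lab W hW).V) = ⟨⟨j, hlt⟩, Fin.last _⟩ := by
      rintro _ h rfl
      rfl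
    refine ⟨⟨⟨j, hlt⟩, 0⟩, ⟨⟨j, hlt⟩, Fin.last _⟩, ?_, ?_, ?_⟩
    · refine List.getElem?_eq_some_iff.2 ⟨by simp; omega, ?_⟩
      simp only [List.getElem_ofFn, Nat.mul_mod_right, if_true]
      exact hstart _ (by omega)
    · refine List.getElem?_eq_some_iff.2 ⟨by simp; omega, ?_⟩
      have h2 : (2 * j + 1) % 2 ≠ 0 := by omega
      simp only [List.getElem_ofFn, h2, if_false]
      exact hend _ (by omega)
    · have key : ∀ m i, (hi : i + m = W[j].length) →
          (threadGraph ty lab W hW).Trail ⟨⟨j, hlt⟩, ⟨i, by simp; omega⟩⟩ (W[j].drop i)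
            ⟨⟨j, hlt⟩, Fin.last _⟩ := by
        intro m
        induction m with
        | zero =>
          intro i hi
          obtain rfl : i = W[j].length := hi
          rw [List.drop_eq_nil_of_le le_rfl]
          exact Trail.nil _
        | succ m ih =>
          intro i hi
          have hi' : i < W[j].length := by omega
          rw [List.drop_eq_getElem_cons hi']
          obtain ⟨h1, h2⟩ := threadGraph_att (hW := hW) hnd (j := ⟨j, hlt⟩) (i := ⟨i, hi'⟩) rfl
            hmem'
          exact Trail.cons h1 h2 (ih (i + 1) (by omega))
      exact key _ 0 (Nat.zero_add _)
  · exact hnd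
  · exact hmem
  · rintro ⟨j, i⟩
    have hpos : (W[j]).length ≠ 0 := fun h =>
      hne _ (List.getElem_mem j.2) (List.length_eq_zero_iff.1 h)
    by_cases hi : i.1 < (W[j]).length
    · obtain ⟨h1, -⟩ := threadGraph_att (hW := hW) hnd (j := j) (i := ⟨i.1, hi⟩) rfl hmem'
      exact ⟨_, List.mem_of_getElem? h1⟩
    · have hi' : i.1 - 1 < (W[j]).length := by omega
      obtain ⟨-, h2⟩ := threadGraph_att (hW := hW) hnd (j := j) (i := ⟨i.1 - 1, hi'⟩) rfl hmem'
      have : i = (⟨i.1 - 1, hi'⟩ : Fin (W[j]).length).succ := Fin.ext (by simp; omega)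
      rw [this]
      exact ⟨_, List.mem_of_getElem? h2⟩
  · classical
    rw [threadGraph_ext_length]
    have hV : Nat.card (threadGraph ty lab W hW).V = W.flatten.length + W.length := by
      change Nat.card (Σ j : Fin W.length, Fin ((W[j]).length + 1)) = _
      rw [Nat.card_sigma]
      simp only [Nat.card_fin, Finset.sum_add_distrib, List.length_flatten]
      rw [← Fin.sum_univ_fun_getElem W List.length]
      simp
    let _ := Fintype.ofFinite E
    have hcount : ∑ e, ty (lab e) / 2 ≤ W.flatten.length := by
      have h1 : (Finset.univ.sigma fun e => Finset.range (ty (lab e) / 2)).card =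
          ∑ e, ty (lab e) / 2 := by simp
      rw [← h1, ← List.toFinset_card_of_nodup hnd]
      refine Finset.card_le_card_of_injOn (fun p => (p.1, p.2)) ?_ ?_
      · intro p hp
        simp only [Finset.coe_sigma, Set.mem_sigma_iff, Finset.coe_range, Set.mem_Iio] at hp
        simp only [List.coe_toFinset, Set.mem_ofPred_eq]
        rw [hmem]
        omega
      · rintro ⟨a, b⟩ - ⟨c, d⟩ - h
        simp only [Prod.mk.injEq] at h
        obtain ⟨rfl, rfl⟩ := h
        rfl
    have hsum : ∑ᶠ e, ty (lab e) = 2 * ∑ e, ty (lab e) / 2 := by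
      rw [finsum_eq_sum_of_fintype, Finset.mul_sum]
      exact Finset.sum_congr rfl fun e _ => (Nat.two_mul_div_two_of_even (heven e)).symm
    change ∑ᶠ e, ty (lab e) + _ ≤ _
    omega

end HGraph


/-! ### The words whose length is a power of two -/

open HGraph

theorem ParallelDerives.of_reflTransGen {Lab : Type} {ty : Lab → ℕ} {I : Type}
    {T : I → Set (HyperRule ty)} {H H' : HGraph ty}
    (h : Relation.ReflTransGen (fun G G' => ∃ i, ParallelDirectlyDerives (T i) G G') H H') :
    ParallelDerives T H H' := by
  rcases Relation.reflTransGen_iff_eq_or_transGen.1 h with rfl | h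
  · exact Or.inr (Iso.refl _)
  · exact Or.inl h

section

variable {Lab : Type} {ty : Lab → ℕ}

theorem mem_doubling_iff (hty : ∀ X, ty X = 2) (b : Lab) (e : Fin 2) (c : ℕ) :
    (e, c) ∈ [[((0 : Fin 2), 0), (1, 0)]].flatten ↔ 2 * c + 1 < ty b := by
  rw [hty]
  fin_cases e <;> simp

theorem mem_doubling (hty : ∀ X, ty X = 2) (b : Lab) (e : Fin 2) (c : ℕ) (hc : 2 * c < ty b) :
    (e, c) ∈ [[((0 : Fin 2), 0), (1, 0)]].flatten :=
  (mem_doubling_iff hty b e c).2 (by rw [hty] at hc ⊢; omega)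

/-- The rule replacing a hyperedge labelled `b` by a path of two hyperedges labelled `b`. -/
noncomputable abbrev doublingRule (hty : ∀ X, ty X = 2) (b : Lab) : HyperRule ty where
  lhs := b
  rhs := threadGraph ty (fun _ : Fin 2 => b) [[(0, 0), (1, 0)]] (mem_doubling hty b)
  type_eq := hty b

variable (hty : ∀ X, ty X = 2)

theorem doublingRule_nodup (b : Lab) : (doublingRule hty b).rhs.ext.Nodup :=
  threadGraph_ext_nodup (hW := mem_doubling hty b) (by simp)

theorem exists_threaded_doublingRule (b : Lab) :
    ∃ l, (doublingRule hty b).rhs.Threaded [l] ∧ l.length = 2 := by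
  refine ⟨_, threaded_threadGraph (hW := mem_doubling hty b) (by simp) (by simp) (mem_doubling_iff hty b)
    fun _ => by simp [hty], rfl⟩

/-- The grammar that doubles all hyperedges in every step, starting from the letter `a`. -/
noncomputable abbrev doublingGrammar [Finite Lab] (a : Lab) : PHRGrammar where
  Lab := Lab
  finite_Lab := inferInstance
  ty := ty
  terminals := Set.univ
  start := a
  I := Unit
  finite_I := inferInstance
  nonempty_I := inferInstance
  tables _ := Set.range (doublingRule hty)
  isTable _ := ⟨Set.finite_range _, fun b => ⟨_, ⟨b, rfl⟩, rfl⟩⟩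

theorem threaded_replace_doubling {H : HGraph ty} {l : List (H.E × ℕ)} (h : H.Threaded [l])
    {ρ : H.E → HyperRule ty} (hρ : ∀ e, ρ e ∈ Set.range (doublingRule hty)
      ∧ (ρ e).lhs = H.lab e) :
    ∃ l', (H.replace Set.univ fun e => (ρ e).rhs).Threaded [l'] ∧ l'.length = l.length * 2 := by
  have hρ' : ∀ e, ∃ m, (ρ e).rhs.Threaded [m] ∧ m.length = 2 ∧ (ρ e).rhs.ext.Nodup := by
    intro e
    obtain ⟨⟨b, hb⟩, -⟩ := hρ e
    rw [← hb]
    obtain ⟨m, hm, hm2⟩ := exists_threaded_doublingRule hty b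
    exact ⟨m, hm, hm2, doublingRule_nodup hty b⟩
  choose m hm hm2 hnd using hρ'
  refine ⟨_, h.replace (σ := fun e => (ρ e).rhs) hm
    (fun e => by rw [← (hρ e).2]; exact (ρ e).type_eq.symm) hnd, ?_⟩
  rw [List.length_flatMap, List.map_congr_left (g := fun _ => 2)]
  · simp
  · rintro ⟨e, c⟩ hc
    have := (h.mem_iff e c).1 (by simpa using hc)
    rw [hty] at this
    obtain rfl : c = 0 := by omega
    simp [substArc, hm2]

theorem doublingGrammar_language [Finite Lab] (a : Lab) {H : HGraph ty}
    (hH : H ∈ (doublingGrammar hty a).language) :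
    ∃ n, H.Represents (List.replicate (2 ^ n) a) := by
  have key : (∃ n l, H.Threaded [l] ∧ l.length = 2 ^ n) ∧ ∀ e, H.lab e = a := by
    refine ParallelDerives.induction (T := (doublingGrammar hty a).tables)
      (P := fun H => (∃ n l, H.Threaded [l] ∧ l.length = 2 ^ n) ∧ ∀ e, H.lab e = a) hH.1 ?_ ?_ ?_
    · rintro G G' ⟨gV, gE, ha, hl, hx⟩ ⟨⟨n, l, h, hlen⟩, hlab⟩
      refine ⟨⟨n, _, h.of_iso ha hl hx, by simpa using hlen⟩, fun e => ?_⟩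
      obtain ⟨e, rfl⟩ := gE.surjective e
      rw [hl, hlab]
    · have h := threaded_handle (ty := ty) (X := a) (by simp [hty])
      simp only [hty] at h
      exact ⟨⟨0, _, h, rfl⟩, fun _ => rfl⟩
    · rintro _ G ρ hρ ⟨⟨n, l, h, hlen⟩, hlab⟩
      obtain ⟨l', h', hlen'⟩ := threaded_replace_doubling hty h hρ
      refine ⟨⟨n + 1, l', h', by rw [hlen', hlen, pow_succ]⟩, ?_⟩
      rintro (⟨e, he⟩ | ⟨⟨e, -⟩, x⟩)
      · exact (he trivial).elim
      · obtain ⟨⟨b, hb⟩, he⟩ := hρ e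
        rw [← hlab e, ← he]
        have hrhs : ∀ y : (ρ e).rhs.E, (ρ e).rhs.lab y = (ρ e).lhs := by
          rw [← hb]
          exact fun _ => rfl
        exact hrhs x
  obtain ⟨⟨n, l, h, hlen⟩, hlab⟩ := key
  refine ⟨n, ?_⟩
  have := h.represents fun e => hty _
  simp only [hlab] at this
  rwa [List.map_const', hlen] at this

theorem exists_mem_doublingGrammar_language [Finite Lab] (a : Lab) (n : ℕ) :
    ∃ H ∈ (doublingGrammar hty a).language, H.Represents (List.replicate (2 ^ n) a) := by
  have key : ∃ H l, Relation.ReflTransGen (fun G G' => ∃ i, ParallelDirectlyDerives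
      ((doublingGrammar hty a).tables i) G G') (handle ty a) H ∧
      H.Threaded [l] ∧ l.length = 2 ^ n := by
    induction n with
    | zero =>
      have h := threaded_handle (ty := ty) (X := a) (by simp [hty])
      simp only [hty] at h
      exact ⟨_, _, Relation.ReflTransGen.refl, h, rfl⟩
    | succ n ih =>
      obtain ⟨H, l, hH, h, hlen⟩ := ih
      have hρ : ∀ e, doublingRule hty (H.lab e) ∈ Set.range (doublingRule hty) ∧
          (doublingRule hty (H.lab e)).lhs = H.lab e := fun e => ⟨⟨_, rfl⟩, rfl⟩
      obtain ⟨l', h', hlen'⟩ := threaded_replace_doubling hty h hρ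
      exact ⟨_, l', hH.tail ⟨(), _, hρ, Iso.refl _⟩, h', by rw [hlen', hlen, pow_succ]⟩
  obtain ⟨H, l, hH, h, hlen⟩ := key
  have hmem : H ∈ (doublingGrammar hty a).language :=
    ⟨ParallelDerives.of_reflTransGen hH, fun _ => trivial⟩
  obtain ⟨m, hm⟩ := doublingGrammar_language hty a hmem
  have hcard := congrArg List.length (hm.unique (h.represents fun e => hty _))
  rw [List.length_replicate, List.length_map, hlen] at hcard
  exact ⟨H, hmem, hcard ▸ hm⟩

end

/-- The language of all words `a ^ (2 ^ n)`. -/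
def powersOfTwo {A : Type*} (a : A) : Language A :=
  {w | ∃ n, w = List.replicate (2 ^ n) a}

theorem powersOfTwo_mem_repetitionFreePHRS {A : Type*} [Finite A] (a : A) :
    powersOfTwo a ∈ RepetitionFreePHRS A 2 := by
  let ι : A ↪ Fin (Nat.card A) := (Finite.equivFin A).toEmbedding
  have hty : ∀ X : Fin (Nat.card A), (fun _ => 2 : Fin (Nat.card A) → ℕ) X = 2 := fun _ => rfl
  refine ⟨doublingGrammar hty (ι a), ι, fun _ _ _ => le_rfl, ?_, ?_, ?_⟩
  · rintro _ _ ⟨b, rfl⟩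
    exact doublingRule_nodup hty b
  · intro H hH
    obtain ⟨n, hn⟩ := doublingGrammar_language hty _ hH
    exact ⟨_, hn⟩
  · ext w
    constructor
    · rintro ⟨H, hH, hw⟩
      obtain ⟨n, hn⟩ := doublingGrammar_language hty _ hH
      refine ⟨List.replicate (2 ^ n) a, ⟨⟨n, rfl⟩, by simp⟩, ?_⟩
      rw [hw.unique hn, List.map_replicate]
    · rintro ⟨_, ⟨⟨n, rfl⟩, -⟩, rfl⟩
      rw [List.map_replicate]
      exact exists_mem_doublingGrammar_language hty (ι a) n

/-- The powers of two are unbounded but contain no arithmetic progression of length three. -/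
theorem powersOfTwo_notMem_repetitionFreeHRS {A : Type*} (a : A) (k : ℕ) :
    powersOfTwo a ∉ RepetitionFreeHRS A k := by
  rintro ⟨G, ι, -, -, h⟩
  rcases G.lengths_bounded_or_exists_progression ι h with ⟨b, hb⟩ | ⟨p, d, hd, h1, h2, h3⟩
  · have := hb _ ⟨b, rfl⟩
    rw [List.length_replicate] at this
    exact absurd this (not_le.2 Nat.lt_two_pow_self)
  · obtain ⟨_, ⟨i, rfl⟩, h1⟩ := h1
    obtain ⟨_, ⟨j, rfl⟩, h2⟩ := h2
    obtain ⟨_, ⟨m, rfl⟩, h3⟩ := h3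
    rw [List.length_replicate] at h1 h2 h3
    have hjm : 2 ^ (j + 1) ≤ 2 ^ m := by
      refine Nat.pow_le_pow_right two_pos ?_
      by_contra hlt
      have := Nat.pow_le_pow_right two_pos (show m ≤ j by omega)
      omega
    rw [pow_succ] at hjm
    have := Nat.two_pow_pos i
    omega

theorem RepetitionFreePHRS.mono {A : Type*} {k k' : ℕ} (h : k ≤ k') :
    RepetitionFreePHRS A k ⊆ RepetitionFreePHRS A k' := by
  rintro L ⟨G, ι, hG, hL⟩
  exact ⟨G, ι, fun i r hr => (hG i r hr).trans h, hL⟩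

theorem repetitionFreePHRS_subset_phrs {A : Type*} {k : ℕ} (h : 2 ≤ k) :
    RepetitionFreePHRS A k ⊆ PHRS A := by
  rintro L ⟨G, ι, hG, -, hL⟩
  exact ⟨k, h, G, ι, hG, hL⟩


/-! ### Grammars with threaded rules -/

/-- The word spelled by a list of arcs when the hyperedge `e` stands for the tuple `t e`. -/
def spell {E B : Type*} (t : E → List (List B)) (l : List (E × ℕ)) : List B :=
  l.flatMap fun x => (t x.1).getD x.2 []

namespace HGraph

variable {Lab : Type} {ty : Lab → ℕ} {B : Type*}

theorem map_spell_handle {X : Lab} {y : List (List B)} (hy : 2 * y.length = ty X) :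
    (((List.range (ty X / 2)).map fun c => [((), c)]).map (spell fun _ => y)) = y := by
  have hlen : ty X / 2 = y.length := by omega
  rw [hlen]
  refine List.ext_getElem (by simp) fun i h1 h2 => ?_
  simp [spell, h2]

theorem map_spell_replace {H : HGraph ty} {σ : H.E → HGraph ty}
    {Wσ : ∀ e, List (List ((σ e).E × ℕ))}
    (t : (H.replace Set.univ fun e => σ e).E → List (List B)) (W : List (List (H.E × ℕ))) :
    (W.map (List.flatMap (substArc σ Wσ))).map (spell t) =
      W.map (spell fun e => (Wσ e).map (spell fun x => t (liftEdge σ e x))) := by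
  rw [List.map_map]
  refine List.map_congr_left fun l _ => ?_
  simp only [Function.comp, spell, List.flatMap_assoc]
  congr 1
  funext x
  refine Eq.trans ?_ (List.getD_map (Wσ x.1) [] (n := x.2)
    (spell fun y => t (liftEdge σ x.1 y))).symm
  simp only [substArc, List.flatMap_map]
  rfl

/-- Every derivable hypergraph is threaded, and filling in tuples for its hyperedges gives a tuple
for the start symbol, provided that this holds for the right-hand sides of the rules. -/
theorem exists_threaded_of_derives {R : Set (HyperRule ty)} {Y : Lab → Set (List (List B))}
    (hty : ∀ X, Even (ty X)) (hY : ∀ X, ∀ y ∈ Y X, 2 * y.length = ty X)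
    (hR : ∀ r ∈ R, r.rhs.ext.Nodup ∧ ∃ W, r.rhs.Threaded W ∧
      ∀ t, (∀ x, t x ∈ Y (r.rhs.lab x)) → W.map (spell t) ∈ Y r.lhs)
    {S : Lab} {H : HGraph ty} (h : Derives R (handle ty S) H) :
    ∃ W, H.Threaded W ∧ ∀ t, (∀ e, t e ∈ Y (H.lab e)) → W.map (spell t) ∈ Y S := by
  have hhandle : ∀ X, ∃ W, (handle ty X).Threaded W ∧
      ∀ t : Unit → List (List B), (∀ e, t e ∈ Y X) → W.map (spell t) ∈ Y X := by
    intro X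
    refine ⟨_, threaded_handle (hty X), fun t ht => ?_⟩
    have := map_spell_handle (hY X _ (ht ()))
    rw [show (fun _ => t ()) = t from rfl] at this
    rw [this]
    exact ht ()
  have hR' : ∀ r ∈ withIdentities R, r.rhs.ext.Nodup ∧ ∃ W, r.rhs.Threaded W ∧
      ∀ t, (∀ x, t x ∈ Y (r.rhs.lab x)) → W.map (spell t) ∈ Y r.lhs := by
    rintro r (hr | ⟨X, rfl⟩)
    · exact hR r hr
    · exact ⟨List.nodup_finRange _, hhandle X⟩
  refine ParallelDerives.induction (P := fun H => ∃ W, H.Threaded W ∧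
    ∀ t, (∀ e, t e ∈ Y (H.lab e)) → W.map (spell t) ∈ Y S)
    (parallelDerives_withIdentities_iff.2 h) ?_ (hhandle S) ?_
  · rintro G G' ⟨gV, gE, ha, hl, hx⟩ ⟨W, hW, hsem⟩
    refine ⟨_, hW.of_iso ha hl hx, fun t ht => ?_⟩
    have := hsem (fun e => t (gE e)) fun e => hl e ▸ ht (gE e)
    rw [List.map_map]
    convert this using 2
    funext l
    simp [spell, List.flatMap_map]
  · rintro - G ρ hρ ⟨W, hW, hsem⟩
    choose hnd Wσ hWσ hsemσ using fun e => hR' (ρ e) (hρ e).1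
    refine ⟨_, hW.replace (σ := fun e => (ρ e).rhs) hWσ
      (fun e => by rw [← (hρ e).2]; exact (ρ e).type_eq.symm) hnd, fun t ht => ?_⟩
    have h := map_spell_replace (σ := fun e => (ρ e).rhs) (Wσ := Wσ) t W
    refine Set.mem_of_eq_of_mem h (hsem _ fun e => ?_)
    rw [← (hρ e).2]
    exact hsemσ e _ fun x => ht (liftEdge (fun e => (ρ e).rhs) e x)

/-- If tuples of level `n + 1` are tuples of level `n` or arise by a rule from tuples of level
`n`, then a threaded hypergraph with tuples of some level for its hyperedges derives one that
spells the same words with tuples of level `0`. -/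
theorem exists_derives_of_levels {R : Set (HyperRule ty)} {Y : ℕ → Lab → Set (List (List B))}
    (hty : ∀ X, Even (ty X)) (hY : ∀ n X, ∀ y ∈ Y n X, 2 * y.length = ty X)
    (hR : ∀ r ∈ R, r.rhs.ext.Nodup)
    (hstep : ∀ n X, ∀ y ∈ Y (n + 1) X, y ∈ Y n X ∨ ∃ r ∈ R, r.lhs = X ∧ ∃ W, r.rhs.Threaded W ∧
      ∃ t, (∀ x, t x ∈ Y n (r.rhs.lab x)) ∧ W.map (spell t) = y)
    (n : ℕ) {H : HGraph ty} {W : List (List (H.E × ℕ))} (hW : H.Threaded W)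
    {t : H.E → List (List B)} (ht : ∀ e, t e ∈ Y n (H.lab e)) :
    ∃ H' W', Derives R H H' ∧ H'.Threaded W' ∧ ∃ t', (∀ e, t' e ∈ Y 0 (H'.lab e)) ∧
      W'.map (spell t') = W.map (spell t) := by
  induction n generalizing H with
  | zero => exact ⟨H, W, Or.inr (Iso.refl H), hW, t, ht, rfl⟩
  | succ n ih =>
    have hstep' : ∀ X, ∀ y ∈ Y (n + 1) X, ∃ r ∈ withIdentities R, r.lhs = X ∧
        r.rhs.ext.Nodup ∧ ∃ W, r.rhs.Threaded W ∧
        ∃ t, (∀ x, t x ∈ Y n (r.rhs.lab x)) ∧ W.map (spell t) = y := by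
      intro X y hy
      rcases hstep n X y hy with h | ⟨r, hr, h⟩
      · exact ⟨identityRule ty X, Or.inr ⟨X, rfl⟩, rfl, List.nodup_finRange _, _,
          threaded_handle (hty X), fun _ => y, fun _ => h, map_spell_handle (hY n X y h)⟩
      · exact ⟨r, Or.inl hr, h.1, hR r hr, h.2⟩
    choose ρ hρ hlhs hnd Wσ hWσ tσ htσ hspell using fun e => hstep' _ (t e) (ht e)
    have hrep := hW.replace (σ := fun e => (ρ e).rhs) hWσ
      (fun e => by rw [← hlhs e]; exact (ρ e).type_eq.symm) hnd
    have hpar : ParallelDirectlyDerives (withIdentities R) H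
        (H.replace Set.univ fun e => (ρ e).rhs) := ⟨ρ, fun e => ⟨hρ e, hlhs e⟩, Iso.refl _⟩
    obtain ⟨H', W', hder, hW', t', ht', hsp⟩ := ih hrep
      (t := Sum.elim (fun _ => []) fun p => tσ p.1 p.2) (by
        rintro (⟨e, he⟩ | ⟨e, x⟩)
        · exact (he trivial).elim
        · exact htσ e x)
    refine ⟨H', W', hpar.derives.trans hder, hW', t', ht', ?_⟩
    refine hsp.trans ((map_spell_replace (σ := fun e => (ρ e).rhs) _ W).trans ?_)
    refine congrArg (fun s => W.map (spell s)) ?_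
    funext e
    exact hspell e

end HGraph


/-! ### Multiple context-free grammars as hyperedge replacement grammars -/

section Demands

variable {A : Type*} {d : ℕ}

/-- The components that a demand requires to be nonempty. A demand `s` prescribes for each
component of a tuple that it is to be nonempty (`some true`), that it is to be empty
(`some false`), or that it will not be used (`none`). -/
def demanded (s : Fin d → Option Bool) : List (Fin d) :=
  (List.finRange d).filter fun c => s c = some true

theorem mem_demanded {s : Fin d → Option Bool} {c : Fin d} :
    c ∈ demanded s ↔ s c = some true := by
  simp [demanded]

theorem nodup_demanded (s : Fin d → Option Bool) : (demanded s).Nodup :=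
  (List.nodup_finRange d).filter _

/-- The tuple `u` satisfies the demand `s`. -/
def MeetsDemand (s : Fin d → Option Bool) (u : Fin d → List A) : Prop :=
  ∀ c b, s c = some b → (b = true ↔ u c ≠ [])

theorem demanded_all_nonempty (hd : d = 1) (w : List A) (u : Fin d → List A)
    (hu : u = fun _ => w) : (demanded fun _ : Fin d => some true).map u = [w] := by
  subst hd hu
  simp [demanded, List.finRange_succ]

end Demands

namespace MCFRule

variable {A : Type*} {N : Type} {dim : N → ℕ}

/-- The value of the function of a rule. -/
def apply (r : MCFRule A dim) (u : (i : Fin r.rhs.length) → Fin (dim (r.rhs.get i)) → List A) :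
    Fin (dim r.lhs) → List A :=
  fun j => (r.body j).flatMap (Sum.elim (fun a => [a]) fun v => u v.1 v.2)

/-- A symbol of the body of a rule contributes at least one letter if the arguments satisfy the
demands `τ`. -/
def Contributes (r : MCFRule A dim) (τ : (i : Fin r.rhs.length) → Fin (dim (r.rhs.get i)) → Option Bool) :
    A ⊕ (Σ i : Fin r.rhs.length, Fin (dim (r.rhs.get i))) → Prop
  | Sum.inl _ => True
  | Sum.inr v => τ v.1 v.2 = some true

/-- The demands `τ` on the arguments of a rule fit the demand `s` on its value: exactly the
variables occurring in used components are used, and the required components are nonempty. -/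
structure Compatible (r : MCFRule A dim) (s : Fin (dim r.lhs) → Option Bool)
    (τ : (i : Fin r.rhs.length) → Fin (dim (r.rhs.get i)) → Option Bool) : Prop where
  used : ∀ i c, τ i c ≠ none ↔ ∃ j, s j ≠ none ∧ Sum.inr ⟨i, c⟩ ∈ r.body j
  nonempty : ∀ j b, s j = some b → (b = true ↔ ∃ x ∈ r.body j, r.Contributes τ x)

variable {r : MCFRule A dim} {s : Fin (dim r.lhs) → Option Bool}
  {τ : (i : Fin r.rhs.length) → Fin (dim (r.rhs.get i)) → Option Bool}
  {u : (i : Fin r.rhs.length) → Fin (dim (r.rhs.get i)) → List A}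

theorem apply_ne_nil_iff (hused : ∀ i c, τ i c ≠ none ↔ ∃ j, s j ≠ none ∧ Sum.inr ⟨i, c⟩ ∈ r.body j)
    (hu : ∀ i, MeetsDemand (τ i) (u i)) {j : Fin (dim r.lhs)} (hj : s j ≠ none) :
    r.apply u j ≠ [] ↔ ∃ x ∈ r.body j, r.Contributes τ x := by
  simp only [apply, ne_eq, List.flatMap_eq_nil_iff, not_forall]
  constructor
  · rintro ⟨x, hx, hne⟩
    refine ⟨x, hx, ?_⟩
    rcases x with a | ⟨i, c⟩
    · trivial
    · obtain ⟨b, hb⟩ := Option.ne_none_iff_exists'.1 ((hused i c).2 ⟨j, hj, hx⟩)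
      have := (hu i c b hb).2 hne
      exact hb.trans (congrArg some this)
  · rintro ⟨x, hx, hc⟩
    refine ⟨x, hx, ?_⟩
    rcases x with a | ⟨i, c⟩
    · simp
    · exact (hu i c true hc).1 rfl

theorem Compatible.meetsDemand (h : r.Compatible s τ) (hu : ∀ i, MeetsDemand (τ i) (u i)) :
    MeetsDemand s (r.apply u) := fun j b hb => by
  rw [h.nonempty j b hb, apply_ne_nil_iff h.used hu (by simp [hb])]

theorem exists_compatible (hs : MeetsDemand s (r.apply u)) :
    ∃ τ, r.Compatible s τ ∧ ∀ i, MeetsDemand (τ i) (u i) := by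
  classical
  let τ : (i : Fin r.rhs.length) → Fin (dim (r.rhs.get i)) → Option Bool := fun i c =>
    if ∃ j, s j ≠ none ∧ Sum.inr ⟨i, c⟩ ∈ r.body j then some (decide (u i c ≠ [])) else none
  have hused : ∀ i c, τ i c ≠ none ↔ ∃ j, s j ≠ none ∧ Sum.inr ⟨i, c⟩ ∈ r.body j := by
    intro i c
    by_cases h : ∃ j, s j ≠ none ∧ Sum.inr ⟨i, c⟩ ∈ r.body j
    · simp only [τ, if_pos h, h]
      simp
    · simp only [τ, if_neg h, h]
      simp
  have hu : ∀ i, MeetsDemand (τ i) (u i) := by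
    intro i c b hb
    by_cases h : ∃ j, s j ≠ none ∧ Sum.inr ⟨i, c⟩ ∈ r.body j
    · simp only [τ, if_pos h, Option.some.injEq] at hb
      rw [← hb, decide_eq_true_iff]
    · simp only [τ, if_neg h] at hb
      exact absurd hb (by simp)
  refine ⟨τ, ⟨hused, fun j b hb => ?_⟩, hu⟩
  rw [hs j b hb, apply_ne_nil_iff hused hu (by simp [hb])]

/-- The positions in the bodies of a rule. -/
abbrev Position (r : MCFRule A dim) : Type := Σ j : Fin (dim r.lhs), Fin (r.body j).length

/-- The symbol at a position. -/
abbrev symbol (r : MCFRule A dim) (p : r.Position) :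
    A ⊕ (Σ i : Fin r.rhs.length, Fin (dim (r.rhs.get i))) :=
  (r.body p.1)[p.2]

/-- By linearity, a variable occurs at one position only. -/
theorem position_eq_of_symbol_eq {p q : r.Position}
    {v : Σ i : Fin r.rhs.length, Fin (dim (r.rhs.get i))} (hp : r.symbol p = Sum.inr v)
    (hq : r.symbol q = Sum.inr v) : p = q := by
  let P := (List.finRange (dim r.lhs)).sigma fun j => List.finRange (r.body j).length
  have hP : P.Nodup := (List.nodup_finRange _).sigma fun j => List.nodup_finRange _
  have hmem : ∀ p, p ∈ P := fun p => List.mem_sigma.2 ⟨List.mem_finRange _, List.mem_finRange _⟩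
  have hflat : (List.ofFn r.body).flatten = P.map r.symbol := by
    simp only [P, List.sigma, List.map_flatMap, List.map_map, List.ofFn_eq_map, ← List.flatMap_def]
    refine congrArg (fun f => List.flatMap f _) (funext fun j => ?_)
    exact (List.map_get_finRange (r.body j)).symm
  have hlin := r.linear
  rw [hflat, List.filterMap_map, List.Nodup, List.pairwise_filterMap] at hlin
  by_contra hne
  have hsymm : Std.Symm fun a a' : r.Position =>
      ∀ b, (Sum.getRight? ∘ r.symbol) a = some b → ∀ b', (Sum.getRight? ∘ r.symbol) a' = some b' →
        b ≠ b' := ⟨fun a a' h b hb b' hb' => (h b' hb' b hb).symm⟩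
  exact hlin.forall (hmem p) (hmem q) hne v (by simp [hp]) v (by simp [hq]) rfl

/-! #### The hypergraph of a rule -/

/-- The hyperedges in the hypergraph of a rule: its arguments, and the letters in the required
components. -/
abbrev Edge (r : MCFRule A dim) (s : Fin (dim r.lhs) → Option Bool) : Type :=
  Fin r.rhs.length ⊕ {p : r.Position // s p.1 = some true ∧ (r.symbol p).isLeft = true}

/-- The arc for a position in a required component; there is none for an empty variable. -/
def arc (r : MCFRule A dim) (s : Fin (dim r.lhs) → Option Bool)
    (τ : (i : Fin r.rhs.length) → Fin (dim (r.rhs.get i)) → Option Bool) (p : r.Position) :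
    Option (r.Edge s × ℕ) :=
  if h : s p.1 = some true ∧ (r.symbol p).isLeft = true then some (Sum.inr ⟨p, h⟩, 0)
  else match r.symbol p with
    | Sum.inl _ => none
    | Sum.inr v => if τ v.1 v.2 = some true then some (Sum.inl v.1, (demanded (τ v.1)).idxOf v.2)
      else none

/-- The paths in the hypergraph of a rule, one for each required component. -/
def paths (r : MCFRule A dim) (s : Fin (dim r.lhs) → Option Bool)
    (τ : (i : Fin r.rhs.length) → Fin (dim (r.rhs.get i)) → Option Bool) :
    List (List (r.Edge s × ℕ)) :=
  (demanded s).map fun j => (List.finRange (r.body j).length).filterMap fun q => r.arc s τ ⟨j, q⟩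

theorem arc_inl {p : r.Position} (hp : s p.1 = some true) {a : A} (ha : r.symbol p = Sum.inl a) :
    ∃ h, r.arc s τ p = some (Sum.inr ⟨p, h⟩, 0) := by
  have h : s p.1 = some true ∧ (r.symbol p).isLeft = true := ⟨hp, by rw [ha]; rfl⟩
  exact ⟨h, dif_pos h⟩

theorem arc_inr {p : r.Position} {v : Σ i : Fin r.rhs.length, Fin (dim (r.rhs.get i))}
    (hv : r.symbol p = Sum.inr v) : r.arc s τ p = if τ v.1 v.2 = some true then
      some (Sum.inl v.1, (demanded (τ v.1)).idxOf v.2) else none := by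
  have h : ¬ (s p.1 = some true ∧ (r.symbol p).isLeft = true) := by
    rw [hv]
    simp
  rw [arc, dif_neg h]
  split
  · rename_i heq
    rw [hv] at heq
    cases heq
  · rename_i heq
    rw [hv] at heq
    cases heq
    rfl

theorem arc_eq_inr_iff {p : r.Position}
    {q : {p : r.Position // s p.1 = some true ∧ (r.symbol p).isLeft = true}} {c : ℕ} :
    r.arc s τ p = some (Sum.inr q, c) ↔ p = q.1 ∧ c = 0 := by
  rw [arc]
  split
  · rename_i h
    simp only [Option.some.injEq, Prod.mk.injEq, Sum.inr.injEq]
    rw [Subtype.ext_iff]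
    exact and_congr_right fun _ => eq_comm
  · rename_i h
    refine iff_of_false ?_ fun hp => h (hp.1 ▸ q.2)
    split
    · simp
    · split_ifs <;> simp

theorem arc_eq_inl_iff {p : r.Position} {i : Fin r.rhs.length} {c : ℕ} :
    r.arc s τ p = some (Sum.inl i, c) ↔ ∃ c', r.symbol p = Sum.inr ⟨i, c'⟩ ∧
      τ i c' = some true ∧ c = (demanded (τ i)).idxOf c' := by
  constructor
  · intro h
    rcases hx : r.symbol p with a | ⟨i', c'⟩
    · rw [arc] at h
      split at h
      · simp at h
      · split at h
        · simp at h
        · rename_i heq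
          rw [hx] at heq
          cases heq
    · rw [arc_inr hx] at h
      split_ifs at h with hτ
      simp only [Option.some.injEq, Prod.mk.injEq, Sum.inl.injEq] at h
      obtain ⟨rfl, h⟩ := h
      exact ⟨c', rfl, hτ, h.symm⟩
  · rintro ⟨c', hx, hτ, rfl⟩
    rw [arc_inr hx, if_pos hτ]

theorem flatten_paths : (r.paths s τ).flatten =
    ((demanded s).sigma fun j => List.finRange (r.body j).length).filterMap (r.arc s τ) := by
  simp only [paths, List.sigma, List.filterMap_flatMap, List.filterMap_map, ← List.flatMap_def]
  rfl

theorem nodup_flatten_paths : (r.paths s τ).flatten.Nodup := by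
  rw [flatten_paths]
  refine List.Nodup.filterMap ?_ ((nodup_demanded s).sigma fun j => List.nodup_finRange _)
  rintro p q ⟨i | p', c⟩ hp hq
  · obtain ⟨c₁, h₁, hτ₁, hc₁⟩ := arc_eq_inl_iff.1 hp
    obtain ⟨c₂, h₂, hτ₂, hc₂⟩ := arc_eq_inl_iff.1 hq
    obtain rfl : c₁ = c₂ := (List.idxOf_inj (mem_demanded.2 hτ₁)).1 (hc₁.symm.trans hc₂)
    exact position_eq_of_symbol_eq h₁ h₂
  · rw [(arc_eq_inr_iff.1 hp).1, (arc_eq_inr_iff.1 hq).1]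

theorem mem_flatten_paths {x : r.Edge s × ℕ} : x ∈ (r.paths s τ).flatten ↔
    ∃ p : r.Position, s p.1 = some true ∧ r.arc s τ p = some x := by
  rw [flatten_paths, List.mem_filterMap]
  constructor
  · rintro ⟨p, hp, hx⟩
    exact ⟨p, mem_demanded.1 (List.mem_sigma.1 hp).1, hx⟩
  · rintro ⟨p, hp, hx⟩
    exact ⟨p, List.mem_sigma.2 ⟨mem_demanded.2 hp, List.mem_finRange _⟩, hx⟩

theorem Compatible.paths_ne_nil (h : r.Compatible s τ) : ∀ l ∈ r.paths s τ, l ≠ [] := by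
  rintro l hl rfl
  obtain ⟨j, hj, hnil⟩ := List.mem_map.1 hl
  have hj := mem_demanded.1 hj
  obtain ⟨x, hx, hc⟩ := (h.nonempty j true hj).1 rfl
  obtain ⟨q, hq, rfl⟩ := List.getElem_of_mem hx
  rw [List.filterMap_eq_nil_iff] at hnil
  have hnone := hnil ⟨q, hq⟩ (List.mem_finRange _)
  rcases hsym : r.symbol ⟨j, ⟨q, hq⟩⟩ with a | v
  · obtain ⟨_, h⟩ := arc_inl (τ := τ) (p := ⟨j, ⟨q, hq⟩⟩) hj hsym
    rw [h] at hnone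
    cases hnone
  · rw [arc_inr hsym] at hnone
    have hc' : r.Contributes τ (Sum.inr v) := by
      rw [← hsym]
      exact hc
    rw [if_pos (show τ v.1 v.2 = some true from hc')] at hnone
    cases hnone

end MCFRule

namespace MCFGrammar

variable {A : Type*} (G : MCFGrammar A) {m : ℕ} (ε : A ≃ Fin m)

/-- The labels of the hyperedge replacement grammar: letters, and nonterminals with a demand on
the tuples they generate. -/
abbrev Label (m : ℕ) : Type := Fin m ⊕ (Σ X : G.N, Fin (G.dim X) → Option Bool)

/-- Letters are binary; otherwise there are two attachments for each required component. -/
abbrev labelType : G.Label m → ℕ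
  | Sum.inl _ => 2
  | Sum.inr p => 2 * (demanded p.2).length

variable {G}

/-- The labels of the hyperedges in the hypergraph of a rule. -/
abbrev edgeLabel (r : MCFRule A G.dim) (s : Fin (G.dim r.lhs) → Option Bool)
    (τ : (i : Fin r.rhs.length) → Fin (G.dim (r.rhs.get i)) → Option Bool) :
    r.Edge s → G.Label m
  | Sum.inl i => Sum.inr ⟨r.rhs.get i, τ i⟩
  | Sum.inr p => Sum.inl (ε ((r.symbol p.1).getLeft p.2.2))

theorem mem_flatten_paths_iff {r : MCFRule A G.dim} {s : Fin (G.dim r.lhs) → Option Bool}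
    {τ : (i : Fin r.rhs.length) → Fin (G.dim (r.rhs.get i)) → Option Bool}
    (h : r.Compatible s τ) (e : r.Edge s) (c : ℕ) :
    (e, c) ∈ (r.paths s τ).flatten ↔ 2 * c + 1 < G.labelType (edgeLabel ε r s τ e) := by
  rw [MCFRule.mem_flatten_paths]
  rcases e with i | p
  · simp only [MCFRule.arc_eq_inl_iff]
    have hlt : 2 * c + 1 < 2 * (demanded (τ i)).length ↔ c < (demanded (τ i)).length := by omega
    change _ ↔ 2 * c + 1 < 2 * (demanded (τ i)).length
    rw [hlt]
    constructor
    · rintro ⟨p, -, c', -, hc', rfl⟩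
      exact List.idxOf_lt_length_iff.2 (mem_demanded.2 hc')
    · intro hc
      have hτ := mem_demanded.1 (List.getElem_mem hc)
      obtain ⟨j, hj, hmem⟩ := (h.used i _).1 (hτ ▸ Option.some_ne_none true)
      obtain ⟨b, hb⟩ := Option.ne_none_iff_exists'.1 hj
      have hbt := (h.nonempty j b hb).2 ⟨_, hmem, hτ⟩
      obtain ⟨q, hq, hsym⟩ := List.getElem_of_mem hmem
      exact ⟨⟨j, ⟨q, hq⟩⟩, hbt ▸ hb, _, hsym, hτ, ((nodup_demanded _).idxOf_getElem c hc).symm⟩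
  · simp only [MCFRule.arc_eq_inr_iff]
    change _ ↔ 2 * c + 1 < 2
    constructor
    · rintro ⟨_, -, -, rfl⟩
      omega
    · intro hc
      exact ⟨p.1, p.2.1, rfl, by omega⟩

theorem even_labelType (X : G.Label m) : Even (G.labelType X) := by
  rcases X with _ | p
  · exact even_two
  · exact even_two_mul _

theorem mem_paths_of_lt {r : MCFRule A G.dim} {s : Fin (G.dim r.lhs) → Option Bool}
    {τ : (i : Fin r.rhs.length) → Fin (G.dim (r.rhs.get i)) → Option Bool}
    (h : r.Compatible s τ) (e : r.Edge s) (c : ℕ)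
    (hc : 2 * c < G.labelType (edgeLabel ε r s τ e)) : (e, c) ∈ (r.paths s τ).flatten := by
  rw [mem_flatten_paths_iff ε h]
  obtain ⟨k, hk⟩ := even_labelType (edgeLabel ε r s τ e)
  omega

/-- The hyperedge replacement rule for an MCF rule with compatible demands. -/
noncomputable abbrev hyperRule (r : MCFRule A G.dim) (s : Fin (G.dim r.lhs) → Option Bool)
    (τ : (i : Fin r.rhs.length) → Fin (G.dim (r.rhs.get i)) → Option Bool)
    (h : r.Compatible s τ) : HyperRule (G.labelType (m := m)) where
  lhs := Sum.inr ⟨r.lhs, s⟩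
  rhs := HGraph.threadGraph G.labelType (edgeLabel ε r s τ) (r.paths s τ) (mem_paths_of_lt ε h)
  type_eq := by
    change 2 * (demanded s).length = (HGraph.threadGraph _ _ _ _).ext.length
    rw [HGraph.threadGraph_ext_length, MCFRule.paths, List.length_map]

theorem threaded_hyperRule {r : MCFRule A G.dim} {s : Fin (G.dim r.lhs) → Option Bool}
    {τ : (i : Fin r.rhs.length) → Fin (G.dim (r.rhs.get i)) → Option Bool}
    (h : r.Compatible s τ) : (hyperRule ε r s τ h).rhs.Threaded (r.paths s τ) :=
  HGraph.threaded_threadGraph (hW := mem_paths_of_lt ε h) h.paths_ne_nil MCFRule.nodup_flatten_paths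
    (mem_flatten_paths_iff ε h) fun _ => even_labelType _

/-- The tuples for the hyperedges in the hypergraph of a rule, given the arguments. -/
def edgeTuple (r : MCFRule A G.dim) (s : Fin (G.dim r.lhs) → Option Bool)
    (τ : (i : Fin r.rhs.length) → Fin (G.dim (r.rhs.get i)) → Option Bool)
    (u : (i : Fin r.rhs.length) → Fin (G.dim (r.rhs.get i)) → List A) :
    r.Edge s → List (List A)
  | Sum.inl i => (demanded (τ i)).map (u i)
  | Sum.inr p => [[(r.symbol p.1).getLeft p.2.2]]

theorem map_spell_paths {r : MCFRule A G.dim} {s : Fin (G.dim r.lhs) → Option Bool}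
    {τ : (i : Fin r.rhs.length) → Fin (G.dim (r.rhs.get i)) → Option Bool}
    (h : r.Compatible s τ) {u : (i : Fin r.rhs.length) → Fin (G.dim (r.rhs.get i)) → List A}
    (hu : ∀ i, MeetsDemand (τ i) (u i)) :
    (r.paths s τ).map (spell (edgeTuple r s τ u)) = (demanded s).map (r.apply u) := by
  rw [MCFRule.paths, List.map_map]
  refine List.map_congr_left fun j hj => ?_
  have hj := mem_demanded.1 hj
  have hbody : (List.finRange (r.body j).length).map (fun q => r.symbol ⟨j, q⟩) = r.body j :=
    List.map_get_finRange (r.body j)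
  rw [MCFRule.apply, ← hbody, List.flatMap_map, Function.comp, spell]
  rw [List.flatMap_def, List.flatMap_def, List.map_filterMap]
  have key : ∀ (l : List (Fin (r.body j).length)),
      (l.filterMap fun q => (r.arc s τ ⟨j, q⟩).map
        fun x => (edgeTuple r s τ u x.1).getD x.2 []).flatten =
      (l.map fun q => Sum.elim (fun a => [a]) (fun v => u v.1 v.2) (r.symbol ⟨j, q⟩)).flatten := by
    intro l
    induction l with
    | nil => rfl
    | cons q l ih =>
      rw [List.map_cons, List.flatten_cons, ← ih]
      rcases hsym : r.symbol ⟨j, q⟩ with a | v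
      · obtain ⟨hp, harc⟩ := MCFRule.arc_inl (τ := τ) (p := ⟨j, q⟩) hj hsym
        rw [List.filterMap_cons_some (by rw [harc]; rfl), List.flatten_cons]
        congr 1
        simp [edgeTuple, hsym]
      · have harc := MCFRule.arc_inr (s := s) (τ := τ) hsym
        have hmem : Sum.inr v ∈ r.body j := hsym ▸ List.getElem_mem q.2
        obtain ⟨b, hb⟩ := Option.ne_none_iff_exists'.1
          ((h.used v.1 v.2).2 ⟨j, by simp [hj], hmem⟩)
        have hub := hu v.1 v.2 b hb
        cases b
        · rw [hb, if_neg (by simp)] at harc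
          rw [List.filterMap_cons_none (by rw [harc]; rfl)]
          have : u v.1 v.2 = [] := by
            by_contra hne
            exact absurd (hub.2 hne) (by simp)
          simp [this]
        · rw [hb, if_pos rfl] at harc
          rw [List.filterMap_cons_some (by rw [harc]; rfl), List.flatten_cons]
          congr 1
          have hidx := List.idxOf_lt_length_iff.2 (mem_demanded.2 hb)
          simp [edgeTuple, hidx]
  exact key _

/-! #### Derivation trees of bounded height -/

/-- The tuples generated by derivation trees of height at most `n`. -/
inductive YieldsWithin (G : MCFGrammar A) : ℕ → (X : G.N) → (Fin (G.dim X) → List A) → Prop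
  | rule (n : ℕ) (r : MCFRule A G.dim) (hr : r ∈ G.rules)
      (u : (i : Fin r.rhs.length) → Fin (G.dim (r.rhs.get i)) → List A)
      (hu : ∀ i, YieldsWithin G n (r.rhs.get i) (u i)) : YieldsWithin G (n + 1) r.lhs (r.apply u)

theorem YieldsWithin.mono {n n' : ℕ} (hn : n ≤ n') {X : G.N} {u : Fin (G.dim X) → List A}
    (h : G.YieldsWithin n X u) : G.YieldsWithin n' X u := by
  induction h generalizing n' with
  | rule n r hr u _ ih =>
    obtain ⟨n', rfl⟩ : ∃ k, n' = k + 1 := ⟨n' - 1, by omega⟩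
    exact YieldsWithin.rule n' r hr u fun i => ih i (by omega)

theorem Yields.exists_yieldsWithin {X : G.N} {u : Fin (G.dim X) → List A} (h : G.Yields X u) :
    ∃ n, G.YieldsWithin n X u := by
  induction h with
  | rule r hr u _ ih =>
    choose n hn using ih
    obtain ⟨M, hM⟩ := (Set.finite_range n).bddAbove
    exact ⟨M + 1, YieldsWithin.rule M r hr u fun i => (hn i).mono (hM ⟨i, rfl⟩)⟩

/-- The tuples a label stands for, when nonterminals may generate the tuples in `Y`: only the
required components are kept. -/
def tuples (Y : (X : G.N) → (Fin (G.dim X) → List A) → Prop) : G.Label m → Set (List (List A))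
  | Sum.inl i => {[[ε.symm i]]}
  | Sum.inr p => {y | ∃ u, Y p.1 u ∧ MeetsDemand p.2 u ∧ y = (demanded p.2).map u}

theorem length_of_mem_tuples {Y : (X : G.N) → (Fin (G.dim X) → List A) → Prop} (X : G.Label m)
    (y : List (List A)) (hy : y ∈ tuples ε Y X) : 2 * y.length = G.labelType X := by
  rcases X with i | p
  · obtain rfl : y = _ := hy
    rfl
  · obtain ⟨u, -, -, rfl⟩ := hy
    rw [List.length_map]

variable (G)

/-- The hyperedge replacement grammar simulating a multiple context-free grammar. Demands make it
possible to avoid empty and unused components. -/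
noncomputable abbrev toHRGrammar : HRGrammar where
  Lab := G.Label m
  finite_Lab := by
    have := G.finite_N
    infer_instance
  ty := G.labelType
  nonterminals := Set.range Sum.inr
  start := Sum.inr ⟨G.start, fun _ => some true⟩
  start_mem := ⟨_, rfl⟩
  rules := ⋃ r ∈ G.rules, Set.range fun p : {p : (Fin (G.dim r.lhs) → Option Bool) ×
    ((i : Fin r.rhs.length) → Fin (G.dim (r.rhs.get i)) → Option Bool) // r.Compatible p.1 p.2} =>
      hyperRule ε r p.1.1 p.1.2 p.2
  finite_rules := G.finite_rules.biUnion fun r _ => Set.finite_range _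
  lhs_mem := by
    intro r' hr'
    simp only [Set.mem_iUnion] at hr'
    obtain ⟨r, -, p, rfl⟩ := hr'
    exact ⟨_, rfl⟩

variable {G}

theorem mem_rules_iff {r' : HyperRule (G.labelType (m := m))} :
    r' ∈ (G.toHRGrammar ε).rules ↔ ∃ r ∈ G.rules, ∃ s τ, ∃ h : r.Compatible s τ,
      hyperRule ε r s τ h = r' := by
  simp only [Set.mem_iUnion]
  constructor
  · rintro ⟨r, hr, ⟨⟨s, τ⟩, h⟩, rfl⟩
    exact ⟨r, hr, s, τ, h, rfl⟩
  · rintro ⟨r, hr, s, τ, h, rfl⟩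
    exact ⟨r, hr, ⟨⟨s, τ⟩, h⟩, rfl⟩

theorem toHRGrammar_repetitionFree : (G.toHRGrammar ε).RepetitionFree := by
  intro r' hr'
  obtain ⟨r, -, s, τ, h, rfl⟩ := (mem_rules_iff ε).1 hr'
  exact HGraph.threadGraph_ext_nodup (hW := mem_paths_of_lt ε h) h.paths_ne_nil

theorem tuples_start {Y : (X : G.N) → (Fin (G.dim X) → List A) → Prop} {y : List (List A)} :
    y ∈ tuples ε Y (Sum.inr ⟨G.start, fun _ => some true⟩) ↔
      ∃ w, Y G.start (fun _ => w) ∧ w ≠ [] ∧ y = [w] := by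
  constructor
  · rintro ⟨u, hu, hne, rfl⟩
    have hpos : 0 < G.dim G.start := G.dim_pos _
    have hconst : u = fun _ => u ⟨0, hpos⟩ := by
      funext c
      refine congrArg u (Fin.ext ?_)
      have h1 : c.1 < G.dim G.start := c.2
      have h2 := G.dim_start
      simp only
      omega
    refine ⟨u ⟨0, hpos⟩, hconst ▸ hu, (hne _ true rfl).1 rfl, ?_⟩
    exact demanded_all_nonempty G.dim_start _ u hconst
  · rintro ⟨w, hw, hne, rfl⟩
    exact ⟨_, hw, fun c b hb => by simp_all, (demanded_all_nonempty G.dim_start w _ rfl).symm⟩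

/-- Derivable hypergraphs spell tuples generated by the given grammar. -/
theorem exists_threaded_of_derives {H : HGraph (G.labelType (m := m))}
    (h : Derives (G.toHRGrammar ε).rules
      (HGraph.handle G.labelType (Sum.inr ⟨G.start, fun _ => some true⟩)) H) :
    ∃ W, H.Threaded W ∧ ∀ t, (∀ e, t e ∈ tuples ε G.Yields (H.lab e)) →
      ∃ w ∈ G.language, w ≠ [] ∧ W.map (spell t) = [w] := by
  obtain ⟨W, hW, hsem⟩ := HGraph.exists_threaded_of_derives (Y := tuples ε G.Yields)
    even_labelType (length_of_mem_tuples ε) (fun r' hr' => by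
      refine ⟨toHRGrammar_repetitionFree ε r' hr', ?_⟩
      obtain ⟨r, hr, s, τ, h, rfl⟩ := (mem_rules_iff ε).1 hr'
      refine ⟨_, threaded_hyperRule ε h, fun t ht => ?_⟩
      choose u hu hmeets htu using fun i => ht (Sum.inl i)
      have : t = edgeTuple r s τ u := by
        funext e
        rcases e with i | p
        · exact htu i
        · have : t (Sum.inr p) = [[ε.symm (ε ((r.symbol p.1).getLeft p.2.2))]] := ht (Sum.inr p)
          rw [this, ε.symm_apply_apply]
          rfl
      refine ⟨r.apply u, Yields.rule r hr u hu, h.meetsDemand hmeets, ?_⟩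
      rw [this]
      exact map_spell_paths h hmeets) h
  exact ⟨W, hW, fun t ht => by
    obtain ⟨w, hw, hne, h⟩ := (tuples_start ε).1 (hsem t ht)
    exact ⟨w, hw, hne, h⟩⟩

/-- Every nonempty generated word is spelled by a derivable hypergraph. -/
theorem exists_derives_of_mem_language {w : List A} (hw : w ∈ G.language) (hne : w ≠ []) :
    ∃ H : HGraph (G.labelType (m := m)), Derives (G.toHRGrammar ε).rules
      (HGraph.handle G.labelType (Sum.inr ⟨G.start, fun _ => some true⟩)) H ∧
      ∃ W, H.Threaded W ∧ ∃ t, (∀ e, ∃ i, H.lab e = Sum.inl i ∧ t e = [[ε.symm i]]) ∧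
        W.map (spell t) = [w] := by
  obtain ⟨n, hn⟩ := Yields.exists_yieldsWithin hw
  have hstart : [w] ∈ tuples ε (G.YieldsWithin n) (Sum.inr ⟨G.start, fun _ => some true⟩) :=
    (tuples_start ε).2 ⟨w, hn, hne, rfl⟩
  obtain ⟨H, W, hder, hW, t, ht, hspell⟩ := HGraph.exists_derives_of_levels
    (R := (G.toHRGrammar ε).rules) (Y := fun n => tuples ε (G.YieldsWithin n)) even_labelType
    (fun _ => length_of_mem_tuples ε) (toHRGrammar_repetitionFree ε) (by
      rintro n (i | ⟨X, s⟩) y hy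
      · exact Or.inl hy
      · right
        obtain ⟨u, hu, hmeets, rfl⟩ := hy
        cases hu with
        | rule _ r hr u hu =>
          obtain ⟨τ, hτ, hmeetsτ⟩ := MCFRule.exists_compatible hmeets
          refine ⟨_, (mem_rules_iff ε).2 ⟨r, hr, s, τ, hτ, rfl⟩, rfl, _, threaded_hyperRule ε hτ,
            edgeTuple r s τ u, ?_, map_spell_paths hτ hmeetsτ⟩
          rintro (i | p)
          · exact ⟨u i, hu i, hmeetsτ i, rfl⟩
          · change [[_]] = [[ε.symm (ε _)]]
            rw [ε.symm_apply_apply]) n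
    (HGraph.threaded_handle (even_labelType _)) (t := fun _ => [w]) fun _ => hstart
  refine ⟨H, hder, W, hW, t, fun e => ?_,
    hspell.trans (HGraph.map_spell_handle (length_of_mem_tuples ε _ _ hstart))⟩
  have he := ht e
  rcases hX : H.lab e with i | p
  · rw [hX] at he
    exact ⟨i, rfl, he⟩
  · rw [hX] at he
    obtain ⟨u, hu, -⟩ := he
    cases hu

/-- A threaded hypergraph with letters as labels represents the word it spells. -/
theorem represents_of_spell {H : HGraph (G.labelType (m := m))} {W : List (List (H.E × ℕ))}
    (hW : H.Threaded W) {t : H.E → List (List A)}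
    (ht : ∀ e, ∃ i, H.lab e = Sum.inl i ∧ t e = [[ε.symm i]]) {w : List A}
    (h : W.map (spell t) = [w]) : H.Represents (w.map fun a => Sum.inl (ε a)) := by
  obtain ⟨l, rfl, rfl⟩ : ∃ l, W = [l] ∧ spell t l = w := by
    match W, h with
    | [l], h => exact ⟨l, rfl, by simpa using h⟩
  have h2 : ∀ e, G.labelType (H.lab e) = 2 := fun e => by
    obtain ⟨i, hi, -⟩ := ht e
    rw [hi]
  convert hW.represents h2 using 1
  have hsnd : ∀ x ∈ l, x.2 = 0 := by
    rintro ⟨e, c⟩ hx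
    have := (hW.mem_iff e c).1 (by simpa using hx)
    rw [h2] at this
    simp only
    omega
  clear hW h
  induction l with
  | nil => rfl
  | cons x l ih =>
    have ih := ih fun y hy => hsnd y (List.mem_cons_of_mem _ hy)
    obtain ⟨i, hi, hti⟩ := ht x.1
    rw [spell] at ih ⊢
    rw [List.flatMap_cons, List.map_append, ih, hsnd x List.mem_cons_self, hti, List.map_cons, hi]
    simp

end MCFGrammar

theorem exists_mem_repetitionFreeHRS_of_mem_mcf {A : Type*} [Finite A] {L : Language A} (hL : L ∈ MCF A) :
    ∃ k, 2 ≤ k ∧ L ∈ RepetitionFreeHRS A k := by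
  obtain ⟨G, rfl⟩ := hL
  have := G.finite_N
  let ε := Finite.equivFin A
  obtain ⟨K, hK⟩ := (Set.finite_range (G.labelType (m := Nat.card A))).bddAbove
  let ι : A ↪ G.Label (Nat.card A) := ⟨fun a => Sum.inl (ε a), fun a b h => by simpa using h⟩
  have hlang : ∀ H ∈ (G.toHRGrammar ε).language, ∃ w ∈ G.language, w ≠ [] ∧
      H.Represents (w.map ι) := by
    rintro H ⟨hH, hterm⟩
    obtain ⟨W, hW, hsem⟩ := MCFGrammar.exists_threaded_of_derives ε hH
    have hlab : ∀ e, ∃ i, H.lab e = Sum.inl i := by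
      intro e
      rcases hX : H.lab e with i | p
      · exact ⟨i, rfl⟩
      · exact (hterm e ⟨p, hX.symm⟩).elim
    choose i hi using hlab
    obtain ⟨w, hw, hne, hspell⟩ := hsem (fun e => [[ε.symm (i e)]]) fun e => by
      rw [hi]
      rfl
    exact ⟨w, hw, hne, MCFGrammar.represents_of_spell ε hW (fun e => ⟨i e, hi e, rfl⟩) hspell⟩
  refine ⟨max 2 K, le_max_left _ _, G.toHRGrammar ε, ι,
    fun r _ => (hK ⟨r.lhs, rfl⟩).trans (le_max_right _ _),
    MCFGrammar.toHRGrammar_repetitionFree ε, fun H hH => ?_, ?_⟩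
  · obtain ⟨w, -, -, hw⟩ := hlang H hH
    exact ⟨_, hw⟩
  · ext v
    constructor
    · rintro ⟨H, hH, hv⟩
      obtain ⟨w, hw, hne, hrep⟩ := hlang H hH
      exact ⟨w, ⟨hw, hne⟩, hrep.unique hv⟩
    · rintro ⟨w, ⟨hw, hne⟩, rfl⟩
      obtain ⟨H, hH, W, hW, t, ht, hspell⟩ := MCFGrammar.exists_derives_of_mem_language ε hw hne
      refine ⟨H, ⟨hH, fun e => ?_⟩, MCFGrammar.represents_of_spell ε hW ht hspell⟩
      obtain ⟨i, hi, -⟩ := ht e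
      rw [hi]
      rintro ⟨p, hp⟩
      cases hp


/-! ### The two strict inclusions -/

theorem mainTheorem2 (A : Type*) [Finite A] :
    (∀ k : ℕ, 2 ≤ k →
      RepetitionFreeHRS A k ⊆ RepetitionFreePHRS A k ∧
      (Nonempty A → RepetitionFreeHRS A k ⊂ RepetitionFreePHRS A k)) ∧
    (MCF A ⊆ PHRS A ∧ (Nonempty A → MCF A ⊂ PHRS A)) := by
  have hsub : MCF A ⊆ PHRS A := by
    intro L hL
    obtain ⟨k, hk, hLk⟩ := exists_mem_repetitionFreeHRS_of_mem_mcf hL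
    exact repetitionFreePHRS_subset_phrs hk (repetitionFreeHRS_subset_repetitionFreePHRS A hk hLk)
  refine ⟨fun k hk => ⟨repetitionFreeHRS_subset_repetitionFreePHRS A hk, ?_⟩, hsub, ?_⟩
  · rintro ⟨a⟩
    refine ⟨repetitionFreeHRS_subset_repetitionFreePHRS A hk, fun h => ?_⟩
    exact powersOfTwo_notMem_repetitionFreeHRS a k
      (h (RepetitionFreePHRS.mono hk (powersOfTwo_mem_repetitionFreePHRS a)))
  · rintro ⟨a⟩
    refine ⟨hsub, fun h => ?_⟩
    obtain ⟨k, -, hk⟩ := exists_mem_repetitionFreeHRS_of_mem_mcf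
      (h (repetitionFreePHRS_subset_phrs le_rfl (powersOfTwo_mem_repetitionFreePHRS a)))
    exact powersOfTwo_notMem_repetitionFreeHRS a k hk
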